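/- Let $\mathcal E$ be a category with finite limits and let $(\mathsf P',\mu',\eta')$ and $(\mathsf P,\mu,\eta)$ be cartesian monads on $\mathcal E$ (the functor preserves pullbacks and all naturality squares of the multiplication and of the unit are pullbacks), equipped with strengths $D'_{A,B}\colon A\times\mathsf P'B\to\mathsf P'(A\times B)$ and $D_{A,B}\colon A\times \mathsf PB\to\mathsf P(A\times B)$ (natural transformations compatible with tensoring with $1$, with associativity of $\times$, and with the unit and multiplication of the monad). Write $D_A\colon A\times\mathsf P1\to\mathsf PA$ for $D_{A,1}$, and $D'_A$ likewise. A $\mathsf P'$-operad $Q$ is a span $\mathsf P'Q_0\xleftarrow{s}Q_1\xrightarrow{t}Q_0$ with a composition $m\colon \mathsf P'Q_1\times_{\mathsf P'Q_0}Q_1\to Q_1$ and a unit $e\colon Q_0\to Q_1$ satisfying the usual source, target, associativity and unit axioms (a monad in the bicategory of $\mathsf P'$-spans); morphisms of $\mathsf P'$-operads are pairs $(f_0,f_1)$ compatible with all this structure. Internal categories and internal functors are defined in the same way with the identity monad. (1) Let $Q$ be a $\mathsf P'$-operad such that $D'_{Q_0}$ is a monomorphism. Let $\bar Q_1$ be the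 pullback of $D'_{Q_0}\colon Q_0\times\mathsf P'1\to\mathsf P'Q_0$ and $s\colon Q_1\to\mathsf P'Q_0$, with source $\bar Q_1\to Q_0\times\mathsf P'1\to Q_0$ and target $\bar Q_1\xrightarrow{j}Q_1\xrightarrow{t}Q_0$. Let $j_2\colon\bar Q_1\times_{Q_0}\bar Q_1\to\mathsf P'Q_1\times_{\mathsf P'Q_0}Q_1$ be the map $(x,y)\mapsto(D'_{Q_1}(j x,\operatorname{sh} y),\,j y)$, where $\operatorname{sh}\colon\bar Q_1\to Q_0\times\mathsf P'1\to\mathsf P'1$. Then $j$ is a monomorphism, there are a unique $\bar m\colon\bar Q_1\times_{Q_0}\bar Q_1\to\bar Q_1$ with $j\bar m=m j_2$ and a unique $\bar e\colon Q_0\to\bar Q_1$ with $j\bar e=e$, and with this composition and unit $Q_0\leftleftarrows\bar Q_1$ is an internal category $\mathcal T_{\mathsf P'}(Q)$. (2) For a morphism $f\colon Q\to B$ of such operads, $f_0$ together with the map $\bar Q_1\to\bar B_1$ induced by $f_0\times\mathsf P'1$ and $f_1$ is an internal functor $\mathcal T_{\mathsf P'}(f)$, and $\mathcal T_{\mathsf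 P'}$ is a functor from the $\mathsf P'$-operads $Q$ with $D'_{Q_0}$ a monomorphism to the categories internal to $\mathcal E$. (3) For an internal category $C$ with $D_{C_0}$ a monomorphism let $\tilde C_1$ be the pullback of $\mathsf Pt\colon\mathsf PC_1\to\mathsf PC_0$ and $D_{C_0}\colon C_0\times\mathsf P1\to\mathsf PC_0$, with $i\colon\tilde C_1\to\mathsf PC_1$ the projection, source $\tilde C_1\xrightarrow{i}\mathsf PC_1\xrightarrow{\mathsf Ps}\mathsf PC_0$ and target $\tilde C_1\to C_0\times\mathsf P1\to C_0$. Its composition is induced by $\mathsf P\tilde C_1\times_{\mathsf PC_0}\tilde C_1\xrightarrow{i_2}\mathsf P^2(C_1\times_{C_0}C_1)\xrightarrow{\mathsf P^2m}\mathsf P^2C_1\xrightarrow{\mu}\mathsf PC_1$, where $i_2$ has components $\mathsf P i$ on $\mathsf P\tilde C_1$ and $\mathsf PD_{C_1}\circ z$, with $z$ the map to $\mathsf P(C_1\times\mathsf P1)\cong\mathsf PC_1\times_{\mathsf PC_0}\mathsf P(C_0\times\mathsf P1)$ given by $i$ and by $\mathsf P$ of the projection $\tilde C_1\to C_0\times\mathsf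 P1$; its unit is induced by $C_0\xrightarrow{\eta}\mathsf PC_0\xrightarrow{\mathsf Pe}\mathsf PC_1$. This is a $\mathsf P$-operad $\mathcal T^{\mathsf P}(C)$ with object of colours $C_0$, and $\mathcal T^{\mathsf P}$ is a functor from these internal categories to $\mathsf P$-operads, with $\mathcal T^{\mathsf P}(f)$ given by $f_0$ and the map induced by $\mathsf Pf_1$ and $f_0\times\mathsf P1$. (4) Composing the two constructions, $Q\mapsto\mathcal T^{\mathsf P}(\mathcal T_{\mathsf P'}(Q))$ and $f\mapsto\mathcal T^{\mathsf P}(\mathcal T_{\mathsf P'}(f))$ is a functor from the $\mathsf P'$-operads $Q$ for which both $D'_{Q_0}$ and $D_{Q_0}$ are monomorphisms to $\mathsf P$-operads. -/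

import Mathlib

open CategoryTheory Limits MonoidalCategory CartesianMonoidalCategory

universe v u

noncomputable section

namespace TCons

variable {E : Type u} [Category.{v} E]

/-! ### Cartesian monads, strengths -/

/-- A monad is cartesian if its functor preserves pullbacks and all naturality squares of its
multiplication and of its unit are pullbacks. -/
class IsCartesianMonad (P : CategoryTheory.Monad E) : Prop where
  preserves : PreservesLimitsOfShape WalkingCospan P.toFunctor
  mu : ∀ {A B : E} (f : A ⟶ B),
    IsPullback (P.map (P.map f)) (P.μ.app A) (P.μ.app B) (P.map f)
  eta : ∀ {A B : E} (f : A ⟶ B), IsPullback f (P.η.app A) (P.η.app B) (P.map f)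

lemma isPullback_map {P : CategoryTheory.Monad E} [IsCartesianMonad P] {A B C X : E} {f : A ⟶ B} {g : A ⟶ C} {h : B ⟶ X} {k : C ⟶ X}
    (sq : IsPullback f g h k) :
    IsPullback (P.map f) (P.map g) (P.map h) (P.map k) := by
  have := IsCartesianMonad.preserves (P := P)
  exact sq.map P.toFunctor

/-- A strength for a monad `P` on a category with finite products: a natural transformation
`A × P B ⟶ P (A × B)` with the usual four axioms. -/
structure Strength [CartesianMonoidalCategory E] (P : CategoryTheory.Monad E) where
  str : ∀ A B : E, A ⊗ P.obj B ⟶ P.obj (A ⊗ B)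
  naturality : ∀ {A A' B B' : E} (f : A ⟶ A') (g : B ⟶ B'),
    (f ⊗ₘ P.map g) ≫ str A' B' = str A B ≫ P.map (f ⊗ₘ g)
  str_one : ∀ A : E, str (𝟙_ E) A ≫ P.map (snd (𝟙_ E) A) = snd (𝟙_ E) (P.obj A)
  str_assoc : ∀ A B C : E,
    (α_ A B (P.obj C)).hom ≫ A ◁ str B C ≫ str A (B ⊗ C) =
      str (A ⊗ B) C ≫ P.map (α_ A B C).hom
  str_eta : ∀ A B : E, A ◁ P.η.app B ≫ str A B = P.η.app (A ⊗ B)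
  str_mu : ∀ A B : E,
    str A (P.obj B) ≫ P.map (str A B) ≫ P.μ.app (A ⊗ B) = A ◁ P.μ.app B ≫ str A B

/-! ### Internal categories -/

section InternalCategories

variable [HasPullbacks E]

/-- The objects and arrows of `E` underlying an internal category. The pullback `C₁ ×_{C₀} C₁`
consists of the pairs `(x, y)` with `t x = s y`, and `m (x, y)` is `x` followed by `y`. -/
structure CatData (E : Type u) [Category.{v} E] [HasPullbacks E] where
  C₀ : E
  C₁ : E
  s : C₁ ⟶ C₀
  t : C₁ ⟶ C₀
  m : pullback t s ⟶ C₁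
  e : C₀ ⟶ C₁

/-- The axioms of an internal category. The object `C₀ ×_{C₀} C₁` is identified with `C₁`, and the
triple fibre product is written `(C₁ ×_{C₀} C₁) ×_{C₀} C₁`. -/
structure CatData.IsCategory (C : CatData E) : Prop where
  m_s : C.m ≫ C.s = pullback.fst C.t C.s ≫ C.s
  m_t : C.m ≫ C.t = pullback.snd C.t C.s ≫ C.t
  e_s : C.e ≫ C.s = 𝟙 C.C₀
  e_t : C.e ≫ C.t = 𝟙 C.C₀
  assoc :
    pullback.lift
        (pullback.fst (pullback.snd C.t C.s ≫ C.t) C.s ≫ C.m)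
        (pullback.snd (pullback.snd C.t C.s ≫ C.t) C.s)
        (by rw [Category.assoc, m_t, pullback.condition]) ≫ C.m =
      pullback.lift
        (pullback.fst (pullback.snd C.t C.s ≫ C.t) C.s ≫ pullback.fst C.t C.s)
        (pullback.lift
            (pullback.fst (pullback.snd C.t C.s ≫ C.t) C.s ≫ pullback.snd C.t C.s)
            (pullback.snd (pullback.snd C.t C.s ≫ C.t) C.s)
            (by rw [Category.assoc, pullback.condition]) ≫ C.m)
        (by simp only [Category.assoc, m_s, pullback.lift_fst_assoc, pullback.condition]) ≫ C.m
  unit_left : pullback.lift (C.s ≫ C.e) (𝟙 C.C₁) (by simp [e_t]) ≫ C.m = 𝟙 C.C₁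
  unit_right : pullback.lift (𝟙 C.C₁) (C.t ≫ C.e) (by simp [e_s]) ≫ C.m = 𝟙 C.C₁

/-- `f₀`, `f₁` form an internal functor. -/
structure CatData.IsFunctor (C B : CatData E) (f₀ : C.C₀ ⟶ B.C₀) (f₁ : C.C₁ ⟶ B.C₁) : Prop where
  src : f₁ ≫ B.s = C.s ≫ f₀
  tgt : f₁ ≫ B.t = C.t ≫ f₀
  unit : C.e ≫ f₁ = f₀ ≫ B.e
  comp : C.m ≫ f₁ =
    pullback.lift (pullback.fst C.t C.s ≫ f₁) (pullback.snd C.t C.s ≫ f₁)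
      (by rw [Category.assoc, Category.assoc, src, tgt, pullback.condition_assoc]) ≫ B.m

/-- Categories internal to `E`. -/
structure InternalCat (E : Type u) [Category.{v} E] [HasPullbacks E] extends CatData E where
  isCategory : toCatData.IsCategory

/-- Internal functors. -/
@[ext]
structure InternalCat.Hom (C B : InternalCat E) where
  f₀ : C.C₀ ⟶ B.C₀
  f₁ : C.C₁ ⟶ B.C₁
  isFunctor : CatData.IsFunctor C.toCatData B.toCatData f₀ f₁

lemma CatData.IsFunctor.id (C : CatData E) : C.IsFunctor C (𝟙 _) (𝟙 _) where
  src := by simp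
  tgt := by simp
  unit := by simp
  comp := by
    rw [Category.comp_id, eq_comm]
    convert Category.id_comp C.m
    apply pullback.hom_ext <;> simp

lemma CatData.IsFunctor.trans {C B A : CatData E} {f₀ : C.C₀ ⟶ B.C₀} {f₁ : C.C₁ ⟶ B.C₁}
    {g₀ : B.C₀ ⟶ A.C₀} {g₁ : B.C₁ ⟶ A.C₁} (hf : C.IsFunctor B f₀ f₁) (hg : B.IsFunctor A g₀ g₁) :
    C.IsFunctor A (f₀ ≫ g₀) (f₁ ≫ g₁) where
  src := by rw [Category.assoc, hg.src, ← Category.assoc, hf.src, Category.assoc]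
  tgt := by rw [Category.assoc, hg.tgt, ← Category.assoc, hf.tgt, Category.assoc]
  unit := by rw [← Category.assoc, hf.unit, Category.assoc, hg.unit, Category.assoc]
  comp := by
    rw [← Category.assoc, hf.comp, Category.assoc, hg.comp, ← Category.assoc]
    congr 1
    apply pullback.hom_ext
    · rw [Category.assoc, pullback.lift_fst, pullback.lift_fst_assoc, pullback.lift_fst,
        Category.assoc]
    · rw [Category.assoc, pullback.lift_snd, pullback.lift_snd_assoc, pullback.lift_snd,
        Category.assoc]

instance : Category.{v} (InternalCat E) where
  Hom C B := InternalCat.Hom C B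
  id C := ⟨𝟙 _, 𝟙 _, .id C.toCatData⟩
  comp f g := ⟨f.f₀ ≫ g.f₀, f.f₁ ≫ g.f₁, f.isFunctor.trans g.isFunctor⟩
  id_comp _ := InternalCat.Hom.ext (Category.id_comp _) (Category.id_comp _)
  comp_id _ := InternalCat.Hom.ext (Category.comp_id _) (Category.comp_id _)
  assoc _ _ _ := InternalCat.Hom.ext (Category.assoc _ _ _) (Category.assoc _ _ _)

end InternalCategories

/-! ### Operads over a monad -/

section Operads

variable [HasPullbacks E]

/-- The objects and arrows of `E` underlying a `P`-operad: a span `P Q₀ ⟵ Q₁ ⟶ Q₀`, a composition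
`P Q₁ ×_{P Q₀} Q₁ ⟶ Q₁` and a unit `Q₀ ⟶ Q₁`. -/
structure OperadData (P : CategoryTheory.Monad E) where
  Q₀ : E
  Q₁ : E
  s : Q₁ ⟶ P.obj Q₀
  t : Q₁ ⟶ Q₀
  m : pullback (P.map t) s ⟶ Q₁
  e : Q₀ ⟶ Q₁

/-- The axioms of a `P`-operad. As `P` preserves pullbacks, `P²Q₁ ×_{P²Q₀} P Q₁` is
`P (P Q₁ ×_{P Q₀} Q₁)`, and the associativity axiom is stated as an equality of two arrows
`P (P Q₁ ×_{P Q₀} Q₁) ×_{P Q₀} Q₁ ⟶ Q₁`. -/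
structure OperadData.IsOperad {P : Monad E} (Q : OperadData P) : Prop where
  m_s : Q.m ≫ Q.s = pullback.fst (P.map Q.t) Q.s ≫ P.map Q.s ≫ P.μ.app Q.Q₀
  m_t : Q.m ≫ Q.t = pullback.snd (P.map Q.t) Q.s ≫ Q.t
  e_s : Q.e ≫ Q.s = P.η.app Q.Q₀
  e_t : Q.e ≫ Q.t = 𝟙 Q.Q₀
  assoc :
    pullback.lift
        (pullback.fst (P.map (pullback.snd (P.map Q.t) Q.s ≫ Q.t)) Q.s ≫ P.map Q.m)
        (pullback.snd (P.map (pullback.snd (P.map Q.t) Q.s ≫ Q.t)) Q.s)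
        (by rw [Category.assoc, ← CategoryTheory.Functor.map_comp, m_t, pullback.condition]) ≫ Q.m =
      pullback.lift
        (pullback.fst (P.map (pullback.snd (P.map Q.t) Q.s ≫ Q.t)) Q.s ≫
          P.map (pullback.fst (P.map Q.t) Q.s) ≫ P.μ.app Q.Q₁)
        (pullback.lift
            (pullback.fst (P.map (pullback.snd (P.map Q.t) Q.s ≫ Q.t)) Q.s ≫
              P.map (pullback.snd (P.map Q.t) Q.s))
            (pullback.snd (P.map (pullback.snd (P.map Q.t) Q.s ≫ Q.t)) Q.s)
            (by rw [Category.assoc, ← CategoryTheory.Functor.map_comp, pullback.condition]) ≫ Q.m)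
        (by
          simp only [Category.assoc, m_s, pullback.lift_fst_assoc]
          rw [← CategoryTheory.Monad.mu_naturality E P Q.t, ← CategoryTheory.Functor.map_comp_assoc, pullback.condition,
            CategoryTheory.Functor.map_comp_assoc]) ≫ Q.m
  unit_left : pullback.lift (Q.s ≫ P.map Q.e) (𝟙 Q.Q₁)
    (by rw [Category.assoc, ← CategoryTheory.Functor.map_comp, e_t]; simp) ≫ Q.m = 𝟙 Q.Q₁
  unit_right : pullback.lift (P.η.app Q.Q₁) (Q.t ≫ Q.e)
    (by rw [Category.assoc, e_s]; exact (CategoryTheory.Monad.unit_naturality E P Q.t).symm) ≫ Q.m = 𝟙 Q.Q₁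

/-- `f₀`, `f₁` form a morphism of `P`-operads. -/
structure OperadData.IsMorphism {P : Monad E} (Q B : OperadData P)
    (f₀ : Q.Q₀ ⟶ B.Q₀) (f₁ : Q.Q₁ ⟶ B.Q₁) : Prop where
  src : f₁ ≫ B.s = Q.s ≫ P.map f₀
  tgt : f₁ ≫ B.t = Q.t ≫ f₀
  unit : Q.e ≫ f₁ = f₀ ≫ B.e
  comp : Q.m ≫ f₁ =
    pullback.lift (pullback.fst (P.map Q.t) Q.s ≫ P.map f₁) (pullback.snd (P.map Q.t) Q.s ≫ f₁)
      (by rw [Category.assoc, Category.assoc, src, ← CategoryTheory.Functor.map_comp, tgt, CategoryTheory.Functor.map_comp,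
        pullback.condition_assoc]) ≫ B.m

/-- `P`-operads. -/
structure POperad (P : CategoryTheory.Monad E) extends OperadData P where
  isOperad : toOperadData.IsOperad

/-- Morphisms of `P`-operads. -/
@[ext]
structure POperad.Hom {P : Monad E} (Q B : POperad P) where
  f₀ : Q.Q₀ ⟶ B.Q₀
  f₁ : Q.Q₁ ⟶ B.Q₁
  isMorphism : OperadData.IsMorphism Q.toOperadData B.toOperadData f₀ f₁

lemma OperadData.IsMorphism.id {P : CategoryTheory.Monad E} (Q : OperadData P) :
    Q.IsMorphism Q (𝟙 _) (𝟙 _) where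
  src := by simp
  tgt := by simp
  unit := by simp
  comp := by
    rw [Category.comp_id, eq_comm]
    convert Category.id_comp Q.m
    apply pullback.hom_ext <;> simp

lemma OperadData.IsMorphism.trans {P : CategoryTheory.Monad E} {Q B A : OperadData P}
    {f₀ : Q.Q₀ ⟶ B.Q₀} {f₁ : Q.Q₁ ⟶ B.Q₁} {g₀ : B.Q₀ ⟶ A.Q₀} {g₁ : B.Q₁ ⟶ A.Q₁}
    (hf : Q.IsMorphism B f₀ f₁) (hg : B.IsMorphism A g₀ g₁) :
    Q.IsMorphism A (f₀ ≫ g₀) (f₁ ≫ g₁) where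
  src := by
    rw [Category.assoc, hg.src, ← Category.assoc, hf.src, Category.assoc,
      CategoryTheory.Functor.map_comp]
  tgt := by rw [Category.assoc, hg.tgt, ← Category.assoc, hf.tgt, Category.assoc]
  unit := by rw [← Category.assoc, hf.unit, Category.assoc, hg.unit, Category.assoc]
  comp := by
    rw [← Category.assoc, hf.comp, Category.assoc, hg.comp, ← Category.assoc]
    congr 1
    apply pullback.hom_ext
    · rw [Category.assoc, pullback.lift_fst, pullback.lift_fst_assoc, pullback.lift_fst,
        Category.assoc, CategoryTheory.Functor.map_comp]
    · rw [Category.assoc, pullback.lift_snd, pullback.lift_snd_assoc, pullback.lift_snd,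
        Category.assoc]

instance (P : CategoryTheory.Monad E) : Category.{v} (POperad P) where
  Hom Q B := POperad.Hom Q B
  id Q := ⟨𝟙 _, 𝟙 _, .id Q.toOperadData⟩
  comp f g := ⟨f.f₀ ≫ g.f₀, f.f₁ ≫ g.f₁, f.isMorphism.trans g.isMorphism⟩
  id_comp _ := POperad.Hom.ext (Category.id_comp _) (Category.id_comp _)
  comp_id _ := POperad.Hom.ext (Category.comp_id _) (Category.comp_id _)
  assoc _ _ _ := POperad.Hom.ext (Category.assoc _ _ _) (Category.assoc _ _ _)

end Operads

/-! ### The strength at the terminal object -/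

variable [CartesianMonoidalCategory E]

namespace Strength

variable {P : Monad E} (D : Strength P)

/-- `D_A : A × P 1 ⟶ P A`, the strength `A × P 1 ⟶ P (A × 1)` followed by `P (A × 1) ≅ P A`. -/
def const (A : E) : A ⊗ P.obj (𝟙_ E) ⟶ P.obj A :=
  D.str A (𝟙_ E) ≫ P.map (fst A (𝟙_ E))

lemma const_naturality {A B : E} (f : A ⟶ B) :
    f ▷ P.obj (𝟙_ E) ≫ D.const B = D.const A ≫ P.map f := by
  have h := D.naturality f (𝟙 (𝟙_ E))
  rw [CategoryTheory.Functor.map_id, tensorHom_id] at h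
  rw [const, const, ← Category.assoc, h]
  simp only [Category.assoc, ← CategoryTheory.Functor.map_comp]
  rw [tensorHom_fst]

lemma lift_const_naturality {X A B : E} (a : X ⟶ A) (p : X ⟶ P.obj (𝟙_ E)) (f : A ⟶ B) :
    lift a p ≫ D.const A ≫ P.map f = lift (a ≫ f) p ≫ D.const B := by
  rw [← const_naturality, ← Category.assoc]
  congr 1
  ext <;> simp

lemma str_snd (A B : E) : D.str A B ≫ P.map (snd A B) = snd A (P.obj B) := by
  have h := D.naturality (toUnit A) (𝟙 B)
  have h' : snd A B = (toUnit A ⊗ₘ 𝟙 B) ≫ snd (𝟙_ E) B := by simp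
  rw [h', CategoryTheory.Functor.map_comp, ← Category.assoc, ← h, Category.assoc, D.str_one]
  simp

lemma str_fst (A B : E) :
    D.str A B ≫ P.map (fst A B) = A ◁ P.map (toUnit B) ≫ D.const A := by
  have h := D.naturality (𝟙 A) (toUnit B)
  rw [id_tensorHom, id_tensorHom] at h
  rw [const, ← Category.assoc, h, Category.assoc, ← CategoryTheory.Functor.map_comp,
    whiskerLeft_fst]

lemma const_toUnit (A : E) :
    D.const A ≫ P.map (toUnit A) = snd A (P.obj (𝟙_ E)) := by
  rw [const, Category.assoc, ← CategoryTheory.Functor.map_comp,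
    toUnit_unique (fst A (𝟙_ E) ≫ toUnit A) (snd A (𝟙_ E)), str_snd]

lemma str_const_mu (A : E) :
    D.str A (P.obj (𝟙_ E)) ≫ P.map (D.const A) ≫ P.μ.app A =
      A ◁ P.μ.app (𝟙_ E) ≫ D.const A := by
  rw [const, ← Category.assoc (A ◁ _), ← D.str_mu, CategoryTheory.Functor.map_comp]
  simp only [Category.assoc]
  rw [← CategoryTheory.Monad.mu_naturality E P]

lemma lift_const_eta {X A : E} (a : X ⟶ A) :
    lift a (toUnit X ≫ P.η.app (𝟙_ E)) ≫ D.const A = a ≫ P.η.app A := by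
  have h : lift a (toUnit X ≫ P.η.app (𝟙_ E)) =
      lift a (toUnit X) ≫ A ◁ P.η.app (𝟙_ E) := by ext <;> simp
  rw [h, const, Category.assoc, ← Category.assoc (A ◁ P.η.app (𝟙_ E)), D.str_eta,
    ← CategoryTheory.Monad.unit_naturality E P, lift_fst_assoc]

/-- Repeating a repetition of `a`: the shapes `p` and `q` are combined by
`(p, q) ↦ μ₁ (D_{P 1} (p, q))`. -/
lemma const_const_mu {X A : E} (a : X ⟶ A) (p q : X ⟶ P.obj (𝟙_ E)) :
    lift (lift a p ≫ D.const A) q ≫ D.const (P.obj A) ≫ P.μ.app A =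
      lift a (lift p q ≫ D.const (P.obj (𝟙_ E)) ≫ P.μ.app (𝟙_ E)) ≫ D.const A := by
  have h₁ : lift (lift a p ≫ D.const A) q ≫ D.const (P.obj A) =
      lift (lift a p) q ≫ D.const (A ⊗ P.obj (𝟙_ E)) ≫ P.map (D.const A) :=
    (D.lift_const_naturality (lift a p) q (D.const A)).symm
  have h₂ : D.const (A ⊗ P.obj (𝟙_ E)) =
      (α_ _ _ _).hom ≫ A ◁ D.const (P.obj (𝟙_ E)) ≫ D.str A (P.obj (𝟙_ E)) := by
    have h := D.str_assoc A (P.obj (𝟙_ E)) (𝟙_ E)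
    have h' := D.naturality (𝟙 A) (fst (P.obj (𝟙_ E)) (𝟙_ E))
    rw [id_tensorHom, id_tensorHom] at h'
    rw [const, const, MonoidalCategory.whiskerLeft_comp, Category.assoc, h', ← Category.assoc,
      ← Category.assoc, Category.assoc (α_ _ _ _).hom, h, Category.assoc,
      ← CategoryTheory.Functor.map_comp]
    congr 2
    ext <;> simp
  have h₃ : lift (lift a p) q ≫ (α_ _ _ _).hom ≫ A ◁ D.const (P.obj (𝟙_ E)) =
      lift a (lift p q ≫ D.const (P.obj (𝟙_ E))) := by
    ext <;> simp
  rw [← Category.assoc, h₁, h₂]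
  simp only [Category.assoc]
  rw [D.str_const_mu, reassoc_of% h₃, ← Category.assoc]
  congr 1
  ext <;> simp

end Strength

lemma isPullback_fst_snd (A B : E) :
    IsPullback (fst A B) (snd A B) (toUnit A) (toUnit B) := by
  refine IsPullback.of_isLimit' ⟨toUnit_unique _ _⟩ (PullbackCone.IsLimit.mk _
    (fun c => lift c.fst c.snd) (fun c => ?_) (fun c => ?_) (fun c m h₁ h₂ => ?_))
  · simp
  · simp
  · ext
    · simpa using h₁
    · simpa using h₂

lemma isPullback_whiskerRight {A B : E} (f : A ⟶ B) (X : E) :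
    IsPullback (f ▷ X) (fst A X) (fst B X) f := by
  refine IsPullback.of_isLimit' ⟨by simp⟩ (PullbackCone.IsLimit.mk _
    (fun c => lift c.snd (c.fst ≫ snd B X)) (fun c => ?_) (fun c => ?_) (fun c m h₁ h₂ => ?_))
  · ext
    · simpa using c.condition.symm
    · simp
  · simp
  · ext
    · simpa using h₂
    · simp [← h₁]

/-! ### From `P`-operads to categories -/

section OperadToCat

variable [HasPullbacks E] {P : CategoryTheory.Monad E} (D : Strength P)

/-- The operations of `Q` all of whose inputs coincide: the pullback of
`D : Q₀ × P 1 ⟶ P Q₀ ⟵ Q₁ : s`. -/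
abbrev catArrows (Q : POperad P) : E := pullback (D.const Q.Q₀) Q.s

/-- The inclusion of these operations into all operations. -/
def catIncl (Q : POperad P) : catArrows D Q ⟶ Q.Q₁ := pullback.snd (D.const Q.Q₀) Q.s

/-- The common input. -/
def catSrc (Q : POperad P) : catArrows D Q ⟶ Q.Q₀ :=
  pullback.fst (D.const Q.Q₀) Q.s ≫ fst Q.Q₀ (P.obj (𝟙_ E))

/-- The shape of the input configuration. -/
def catShape (Q : POperad P) : catArrows D Q ⟶ P.obj (𝟙_ E) :=
  pullback.fst (D.const Q.Q₀) Q.s ≫ snd Q.Q₀ (P.obj (𝟙_ E))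

/-- The output. -/
def catTgt (Q : POperad P) : catArrows D Q ⟶ Q.Q₀ := catIncl D Q ≫ Q.t

lemma catIncl_s (Q : POperad P) :
    catIncl D Q ≫ Q.s = lift (catSrc D Q) (catShape D Q) ≫ D.const Q.Q₀ := by
  rw [catIncl, catSrc, catShape, ← pullback.condition]
  congr 1
  ext <;> simp

/-- The comparison of the composable pairs: it sends `(x, y)` to the pair of `y` and the repetition
of `x` over the inputs of `y`. -/
def catIncl₂ (Q : POperad P) :
    pullback (catTgt D Q) (catSrc D Q) ⟶ pullback (P.map Q.t) Q.s :=
  pullback.lift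
    (lift (pullback.fst (catTgt D Q) (catSrc D Q) ≫ catIncl D Q)
      (pullback.snd (catTgt D Q) (catSrc D Q) ≫ catShape D Q) ≫ D.const Q.Q₁)
    (pullback.snd (catTgt D Q) (catSrc D Q) ≫ catIncl D Q)
    (by
      rw [Category.assoc, D.lift_const_naturality, Category.assoc, Category.assoc, catIncl_s,
        ← catTgt, pullback.condition, ← Category.assoc, comp_lift])

/-- The shape of a composite. -/
def catShape₂ (Q : POperad P) : pullback (catTgt D Q) (catSrc D Q) ⟶ P.obj (𝟙_ E) :=
  lift (pullback.fst (catTgt D Q) (catSrc D Q) ≫ catShape D Q)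
      (pullback.snd (catTgt D Q) (catSrc D Q) ≫ catShape D Q) ≫
    D.const (P.obj (𝟙_ E)) ≫ P.μ.app (𝟙_ E)

/-- The composite of `(x, y)` is the composite in `Q` of `y` with the repetition of `x`. -/
def catComp (Q : POperad P) : pullback (catTgt D Q) (catSrc D Q) ⟶ catArrows D Q :=
  pullback.lift
    (lift (pullback.fst (catTgt D Q) (catSrc D Q) ≫ catSrc D Q) (catShape₂ D Q))
    (catIncl₂ D Q ≫ Q.m)
    (by
      rw [catShape₂, ← D.const_const_mu, Category.assoc, Q.isOperad.m_s, catIncl₂,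
        pullback.lift_fst_assoc, Category.assoc, ← Category.assoc (D.const Q.Q₁),
        ← D.const_naturality, Category.assoc, ← comp_lift_assoc, ← catIncl_s]
      simp only [← Category.assoc]
      congr 2
      ext <;> simp)

/-- The unit is that of `Q`. -/
def catUnit (Q : POperad P) : Q.Q₀ ⟶ catArrows D Q :=
  pullback.lift (lift (𝟙 Q.Q₀) (toUnit Q.Q₀ ≫ P.η.app (𝟙_ E))) Q.e
    (by rw [D.lift_const_eta, Category.id_comp, Q.isOperad.e_s])

/-- The internal category `T_P(Q)` associated with a `P`-operad `Q`. -/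
abbrev catOfOperad (Q : POperad P) : CatData E where
  C₀ := Q.Q₀
  C₁ := catArrows D Q
  s := catSrc D Q
  t := catTgt D Q
  m := catComp D Q
  e := catUnit D Q

/-- The action on arrows of the functor `T_P(f)`. -/
def catOfOperadMap {Q B : POperad P} (f : Q ⟶ B) : catArrows D Q ⟶ catArrows D B :=
  pullback.lift (pullback.fst (D.const Q.Q₀) Q.s ≫ f.f₀ ▷ P.obj (𝟙_ E)) (catIncl D Q ≫ f.f₁)
    (by
      rw [Category.assoc, D.const_naturality, Category.assoc, f.isMorphism.src,
        ← Category.assoc, ← Category.assoc]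
      exact congrArg (· ≫ P.map f.f₀) (pullback.condition (f := D.const Q.Q₀) (g := Q.s)))

/-- The `P`-operads `Q` for which `D_{Q₀}` is a monomorphism. -/
def monoOperad : ObjectProperty (POperad P) := fun Q => Mono (D.const Q.Q₀)

end OperadToCat

/-! ### From categories to `P`-operads -/

section CatToOperad

variable [HasPullbacks E] {P : CategoryTheory.Monad E} [IsCartesianMonad P] (D : Strength P)

/-- The operations: the pullback of `P t : P C₁ ⟶ P C₀ ⟵ C₀ × P 1 : D`. -/
abbrev opArrows (C : InternalCat E) : E := pullback (P.map C.t) (D.const C.C₀)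

/-- The configuration of arrows underlying an operation. -/
def opIncl (C : InternalCat E) : opArrows D C ⟶ P.obj C.C₁ :=
  pullback.fst (P.map C.t) (D.const C.C₀)

/-- The input configuration. -/
def opSrc (C : InternalCat E) : opArrows D C ⟶ P.obj C.C₀ := opIncl D C ≫ P.map C.s

/-- The common target of these arrows. -/
def opTgt (C : InternalCat E) : opArrows D C ⟶ C.C₀ :=
  pullback.snd (P.map C.t) (D.const C.C₀) ≫ fst C.C₀ (P.obj (𝟙_ E))

/-- For a pair of a configuration `w` of operations and an operation `y`, the configuration of the
pairs of an arrow of `y` and of the shape of the operation of `w` placed there. It lies in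
`P (C₁ × P 1)`, which is the pullback of `P C₁` and `P (C₀ × P 1)` over `P C₀`. -/
def opShapes (C : InternalCat E) :
    pullback (P.map (opTgt D C)) (opSrc D C) ⟶ P.obj (C.C₁ ⊗ P.obj (𝟙_ E)) :=
  (isPullback_map (isPullback_whiskerRight C.s (P.obj (𝟙_ E)))).lift
    (pullback.fst (P.map (opTgt D C)) (opSrc D C) ≫
      P.map (pullback.snd (P.map C.t) (D.const C.C₀)))
    (pullback.snd (P.map (opTgt D C)) (opSrc D C) ≫ opIncl D C)
    (by
      rw [Category.assoc, Category.assoc, ← CategoryTheory.Functor.map_comp, ← opTgt, ← opSrc,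
        pullback.condition])

lemma opShapes_map_fst (C : InternalCat E) :
    opShapes D C ≫ P.map (fst C.C₁ (P.obj (𝟙_ E))) =
      pullback.snd (P.map (opTgt D C)) (opSrc D C) ≫ opIncl D C :=
  IsPullback.lift_snd _ _ _ _

lemma opShapes_map_s (C : InternalCat E) :
    opShapes D C ≫ P.map (C.s ▷ P.obj (𝟙_ E)) =
      pullback.fst (P.map (opTgt D C)) (opSrc D C) ≫
        P.map (pullback.snd (P.map C.t) (D.const C.C₀)) :=
  IsPullback.lift_fst _ _ _ _

/-- The comparison of the composable pairs with the configurations of configurations of composable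
pairs of arrows of `C`. -/
def opIncl₂ (C : InternalCat E) :
    pullback (P.map (opTgt D C)) (opSrc D C) ⟶ P.obj (P.obj (pullback C.t C.s)) :=
  (isPullback_map (isPullback_map (IsPullback.of_hasPullback C.t C.s))).lift
    (pullback.fst (P.map (opTgt D C)) (opSrc D C) ≫ P.map (opIncl D C))
    (opShapes D C ≫ P.map (D.const C.C₁))
    (by
      rw [Category.assoc, Category.assoc, ← CategoryTheory.Functor.map_comp P.toFunctor (D.const _),
        ← D.const_naturality, CategoryTheory.Functor.map_comp, reassoc_of% (opShapes_map_s D C),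
        ← CategoryTheory.Functor.map_comp, ← CategoryTheory.Functor.map_comp, opIncl,
        pullback.condition])

/-- The shape of a composite. -/
def opShape₂ (C : InternalCat E) :
    pullback (P.map (opTgt D C)) (opSrc D C) ⟶ P.obj (𝟙_ E) :=
  opShapes D C ≫ P.map (snd C.C₁ (P.obj (𝟙_ E))) ≫ P.μ.app (𝟙_ E)

/-- The outputs of the inner operations are obtained by repeating the output of the outer one. -/
lemma opShapes_map_t (C : InternalCat E) :
    opShapes D C ≫ P.map (C.t ▷ P.obj (𝟙_ E)) =
      lift (pullback.snd (P.map (opTgt D C)) (opSrc D C) ≫ opTgt D C)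
        (opShapes D C ≫ P.map (snd C.C₁ (P.obj (𝟙_ E)))) ≫ D.str C.C₀ (P.obj (𝟙_ E)) := by
  apply (isPullback_map (isPullback_fst_snd C.C₀ (P.obj (𝟙_ E)))).hom_ext
  · have h : opShapes D C ≫ P.map (snd C.C₁ (P.obj (𝟙_ E))) ≫ P.map (toUnit (P.obj (𝟙_ E))) =
        pullback.snd (P.map (opTgt D C)) (opSrc D C) ≫
          pullback.snd (P.map C.t) (D.const C.C₀) ≫ snd C.C₀ (P.obj (𝟙_ E)) := by
      rw [← CategoryTheory.Functor.map_comp,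
        toUnit_unique (snd C.C₁ (P.obj (𝟙_ E)) ≫ toUnit _)
          (fst C.C₁ (P.obj (𝟙_ E)) ≫ C.t ≫ toUnit _),
        CategoryTheory.Functor.map_comp, CategoryTheory.Functor.map_comp, reassoc_of% (opShapes_map_fst D C),
        ← D.const_toUnit, opIncl, pullback.condition_assoc]
    have h' : lift (pullback.snd (P.map (opTgt D C)) (opSrc D C) ≫ opTgt D C)
        (opShapes D C ≫ P.map (snd C.C₁ (P.obj (𝟙_ E)))) ≫ C.C₀ ◁ P.map (toUnit _) =
        pullback.snd (P.map (opTgt D C)) (opSrc D C) ≫ pullback.snd (P.map C.t) (D.const C.C₀) := by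
      ext
      · simp [opTgt]
      · simpa using h
    rw [Category.assoc, Category.assoc, D.str_fst, ← CategoryTheory.Functor.map_comp,
      whiskerRight_fst, CategoryTheory.Functor.map_comp, reassoc_of% (opShapes_map_fst D C),
      reassoc_of% h', opIncl, pullback.condition]
  · rw [Category.assoc, Category.assoc, D.str_snd, ← CategoryTheory.Functor.map_comp,
      whiskerRight_snd, lift_snd]

/-- Composition is composition in `C` of configurations of configurations. -/
def opComp (C : InternalCat E) :
    pullback (P.map (opTgt D C)) (opSrc D C) ⟶ opArrows D C :=
  pullback.lift
    (opIncl₂ D C ≫ P.map (P.map C.m) ≫ P.μ.app C.C₁)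
    (lift (pullback.snd (P.map (opTgt D C)) (opSrc D C) ≫ opTgt D C) (opShape₂ D C))
    (by
      have h : lift (pullback.snd (P.map (opTgt D C)) (opSrc D C) ≫ opTgt D C) (opShape₂ D C) =
          lift (pullback.snd (P.map (opTgt D C)) (opSrc D C) ≫ opTgt D C)
            (opShapes D C ≫ P.map (snd C.C₁ (P.obj (𝟙_ E)))) ≫ C.C₀ ◁ P.μ.app (𝟙_ E) := by
        ext <;> simp [opShape₂]
      rw [h, Category.assoc, Category.assoc, Category.assoc, ← D.str_const_mu,
        ← CategoryTheory.Monad.mu_naturality E P, ← CategoryTheory.Functor.map_comp_assoc,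
        ← CategoryTheory.Functor.map_comp, C.isCategory.m_t, CategoryTheory.Functor.map_comp,
        CategoryTheory.Functor.map_comp, Category.assoc, opIncl₂, IsPullback.lift_snd_assoc,
        Category.assoc, ← CategoryTheory.Functor.map_comp_assoc _ (D.const C.C₁),
        ← D.const_naturality, CategoryTheory.Functor.map_comp, Category.assoc,
        reassoc_of% (opShapes_map_t D C)])

/-- The unit at `c` is the one-element configuration of the identity of `c`. -/
def opUnit (C : InternalCat E) : C.C₀ ⟶ opArrows D C :=
  pullback.lift (P.η.app C.C₀ ≫ P.map C.e) (lift (𝟙 C.C₀) (toUnit C.C₀ ≫ P.η.app (𝟙_ E)))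
    (by
      rw [D.lift_const_eta, Category.assoc, ← CategoryTheory.Functor.map_comp, C.isCategory.e_t]
      simp)

/-- The `P`-operad `T^P(C)` associated with an internal category `C`. -/
abbrev operadOfCat (C : InternalCat E) : OperadData P where
  Q₀ := C.C₀
  Q₁ := opArrows D C
  s := opSrc D C
  t := opTgt D C
  m := opComp D C
  e := opUnit D C

/-- The action on operations of the morphism of operads `T^P(f)`. -/
def operadOfCatMap {C B : InternalCat E} (f : C ⟶ B) : opArrows D C ⟶ opArrows D B :=
  pullback.lift (opIncl D C ≫ P.map f.f₁)
    (pullback.snd (P.map C.t) (D.const C.C₀) ≫ f.f₀ ▷ P.obj (𝟙_ E))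
    (by
      rw [Category.assoc, Category.assoc, D.const_naturality, ← CategoryTheory.Functor.map_comp,
        f.isFunctor.tgt, CategoryTheory.Functor.map_comp, opIncl, pullback.condition_assoc])

/-- The internal categories `C` for which `D_{C₀}` is a monomorphism. -/
def monoCat : ObjectProperty (InternalCat E) := fun C => Mono (D.const C.C₀)

end CatToOperad

end TCons

end

open TCons

namespace TCons

/-! ### Composition in an operad on generalized elements -/

section

variable {E : Type u} [Category.{v} E] [HasPullbacks E] {P : CategoryTheory.Monad E}

/-! The strength at the terminal object is a repetition map: it sends a point and a shape to the
configuration of that shape that is constant at the point. Three facts about it carry the proof: it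
is natural, repetition along the unit shape is the unit of the monad (`lift_const_eta`), and
iterated repetition is repetition along the composite shape (`const_const_mu`).

An arrow of the category built from an operad is an operation whose inputs are one repeated colour.
As repetition of colours is a monomorphism, so is its pullback `catIncl`, and equations between such
arrows can be tested among the operations. There `lift_catComp_incl` makes each composite an
operadic one, whose inner configuration is a repetition. The three facts identify these
configurations, and the category axioms become the operad axioms.

An operation of the operad built from a category is a configuration of arrows whose targets form a
repetition. Again the inclusion `opIncl` is a monomorphism, so equations can be tested in `P C₁`.
Since `P` preserves pullbacks, a configuration of configurations of composable pairs is determined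
by its two components; hence `lift_opComp_incl`, by which a composite may be computed from any such
configuration with the right components. For associativity (`operadOfCat_assoc`) one builds a single
element of `P³` of the object of composable triples. The two sides compose these triples with the
two bracketings and flatten the three levels in the two possible orders, so they agree by
associativity in `C` and in the monad.

Both constructions keep the object of colours and are compatible with morphisms by naturality of
repetition. This gives the functors, and lets them be composed. -/

lemma pullback_comp_lift {X Y A B C : E} {f : A ⟶ C} {g : B ⟶ C} (k : Y ⟶ X) (a : X ⟶ A)
    (b : X ⟶ B) (h : a ≫ f = b ≫ g) :
    k ≫ pullback.lift a b h =
      pullback.lift (k ≫ a) (k ≫ b) (by rw [Category.assoc, h, Category.assoc]) := by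
  apply pullback.hom_ext
  · rw [Category.assoc, pullback.lift_fst, pullback.lift_fst]
  · rw [Category.assoc, pullback.lift_snd, pullback.lift_snd]

/-- The composite in `Q` of `y` with a configuration `x` of operations, on generalized elements. -/
noncomputable abbrev OperadData.comp (Q : OperadData P) {X : E} (x : X ⟶ P.obj Q.Q₁) (y : X ⟶ Q.Q₁)
    (h : x ≫ P.map Q.t = y ≫ Q.s) : X ⟶ Q.Q₁ :=
  pullback.lift x y h ≫ Q.m

lemma OperadData.comp_congr (Q : OperadData P) {X : E} {x x' : X ⟶ P.obj Q.Q₁} {y y' : X ⟶ Q.Q₁}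
    (hx : x = x') (hy : y = y') (h : x ≫ P.map Q.t = y ≫ Q.s) (h' : x' ≫ P.map Q.t = y' ≫ Q.s) :
    Q.comp x y h = Q.comp x' y' h' := by
  subst hx hy; rfl

lemma OperadData.comp_precomp (Q : OperadData P) {X Y : E} (f : Y ⟶ X) (x : X ⟶ P.obj Q.Q₁)
    (y : X ⟶ Q.Q₁) (h : x ≫ P.map Q.t = y ≫ Q.s) :
    f ≫ Q.comp x y h = Q.comp (f ≫ x) (f ≫ y) (by rw [Category.assoc, h, Category.assoc]) := by
  rw [OperadData.comp, ← Category.assoc]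
  congr 1
  exact pullback_comp_lift _ _ _ _

/-- Associativity in an operad, on generalized elements. -/
lemma OperadData.IsOperad.comp_assoc {Q : OperadData P} (hQ : Q.IsOperad) {X : E}
    (w : X ⟶ P.obj (pullback (P.map Q.t) Q.s)) (z : X ⟶ Q.Q₁)
    (h : w ≫ P.map (pullback.snd (P.map Q.t) Q.s ≫ Q.t) = z ≫ Q.s)
    (h₁ h₂ h₃) :
    Q.comp (w ≫ P.map Q.m) z h₁ =
      Q.comp (w ≫ P.map (pullback.fst (P.map Q.t) Q.s) ≫ P.μ.app Q.Q₁)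
        (Q.comp (w ≫ P.map (pullback.snd (P.map Q.t) Q.s)) z h₂) h₃ := by
  have := congrArg (pullback.lift w z h ≫ ·) hQ.assoc
  erw [OperadData.comp_precomp, OperadData.comp_precomp] at this
  refine (OperadData.comp_congr Q ?_ ?_ _ _).trans (this.trans (OperadData.comp_congr Q ?_ ?_ _ _))
  · rw [pullback.lift_fst_assoc]
  · rw [pullback.lift_snd]
  · rw [pullback.lift_fst_assoc]
  · erw [OperadData.comp_precomp]
    apply OperadData.comp_congr
    · rw [pullback.lift_fst_assoc]
    · rw [pullback.lift_snd]

lemma OperadData.IsOperad.comp_unit_left {Q : OperadData P} (hQ : Q.IsOperad) {X : E}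
    (x : X ⟶ Q.Q₁) (h) : Q.comp (x ≫ Q.s ≫ P.map Q.e) x h = x := by
  have := congrArg (x ≫ ·) hQ.unit_left
  erw [OperadData.comp_precomp] at this
  simpa only [Category.comp_id] using this

lemma OperadData.IsOperad.comp_unit_right {Q : OperadData P} (hQ : Q.IsOperad) {X : E}
    (x : X ⟶ Q.Q₁) (h) : Q.comp (x ≫ P.η.app Q.Q₁) (x ≫ Q.t ≫ Q.e) h = x := by
  have := congrArg (x ≫ ·) hQ.unit_right
  erw [OperadData.comp_precomp] at this
  simpa only [Category.comp_id] using this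

end

/-! ### The internal category of an operad: axioms -/

section

variable {E : Type u} [Category.{v} E] [CartesianMonoidalCategory E] [HasPullbacks E]
  {P : CategoryTheory.Monad E} (D : Strength P)

lemma mono_catIncl (Q : POperad P) [Mono (D.const Q.Q₀)] : Mono (catIncl D Q) :=
  inferInstanceAs (Mono (pullback.snd (D.const Q.Q₀) Q.s))

lemma catComp_incl (Q : POperad P) : catComp D Q ≫ catIncl D Q = catIncl₂ D Q ≫ Q.m :=
  pullback.lift_snd _ _ _

lemma catUnit_incl (Q : POperad P) : catUnit D Q ≫ catIncl D Q = Q.e :=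
  pullback.lift_snd _ _ _

lemma catComp_src (Q : POperad P) :
    catComp D Q ≫ catSrc D Q = pullback.fst (catTgt D Q) (catSrc D Q) ≫ catSrc D Q := by
  change _ ≫ pullback.fst _ _ ≫ fst _ _ = _
  rw [catComp, pullback.lift_fst_assoc, lift_fst]

lemma catComp_shape (Q : POperad P) : catComp D Q ≫ catShape D Q = catShape₂ D Q := by
  rw [catComp, catShape, pullback.lift_fst_assoc, lift_snd]

lemma catComp_tgt (Q : POperad P) :
    catComp D Q ≫ catTgt D Q = pullback.snd (catTgt D Q) (catSrc D Q) ≫ catTgt D Q := by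
  change catComp D Q ≫ catIncl D Q ≫ Q.t = _ ≫ catIncl D Q ≫ Q.t
  rw [← Category.assoc, catComp_incl, Category.assoc, Q.isOperad.m_t, catIncl₂,
    pullback.lift_snd_assoc, Category.assoc]

lemma catUnit_src (Q : POperad P) : catUnit D Q ≫ catSrc D Q = 𝟙 _ := by
  rw [catUnit, catSrc, pullback.lift_fst_assoc, lift_fst]

lemma catUnit_shape (Q : POperad P) :
    catUnit D Q ≫ catShape D Q = toUnit Q.Q₀ ≫ P.η.app (𝟙_ E) := by
  rw [catUnit, catShape, pullback.lift_fst_assoc, lift_snd]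

lemma catUnit_tgt (Q : POperad P) : catUnit D Q ≫ catTgt D Q = 𝟙 _ := by
  rw [catTgt, ← Category.assoc, catUnit_incl, Q.isOperad.e_t]

lemma lift_catIncl₂_fst (Q : POperad P) {X : E} (x y : X ⟶ catArrows D Q)
    (h : x ≫ catTgt D Q = y ≫ catSrc D Q) :
    pullback.lift x y h ≫ catIncl₂ D Q ≫ pullback.fst (P.map Q.t) Q.s =
      lift (x ≫ catIncl D Q) (y ≫ catShape D Q) ≫ D.const Q.Q₁ := by
  rw [catIncl₂, pullback.lift_fst, comp_lift_assoc, pullback.lift_fst_assoc,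
    pullback.lift_snd_assoc]

lemma lift_catIncl₂_snd (Q : POperad P) {X : E} (x y : X ⟶ catArrows D Q)
    (h : x ≫ catTgt D Q = y ≫ catSrc D Q) :
    pullback.lift x y h ≫ catIncl₂ D Q ≫ pullback.snd (P.map Q.t) Q.s = y ≫ catIncl D Q := by
  rw [catIncl₂, pullback.lift_snd, pullback.lift_snd_assoc]

lemma lift_catShape₂ (Q : POperad P) {X : E} (x y : X ⟶ catArrows D Q)
    (h : x ≫ catTgt D Q = y ≫ catSrc D Q) :
    pullback.lift x y h ≫ catShape₂ D Q =
      lift (x ≫ catShape D Q) (y ≫ catShape D Q) ≫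
        D.const (P.obj (𝟙_ E)) ≫ P.μ.app (𝟙_ E) := by
  rw [catShape₂, comp_lift_assoc, pullback.lift_fst_assoc, pullback.lift_snd_assoc]

/-- The configuration `p` and the operation `q` are free up to equality, so that a composite can be
brought directly to the form in which an operad axiom applies, without rewriting inside a dependent
`pullback.lift`. -/
lemma lift_catComp_incl (Q : POperad P) {X : E} (x y : X ⟶ catArrows D Q)
    (h : x ≫ catTgt D Q = y ≫ catSrc D Q)
    {p : X ⟶ P.obj Q.Q₁} {q : X ⟶ Q.Q₁}
    (hp : lift (x ≫ catIncl D Q) (y ≫ catShape D Q) ≫ D.const Q.Q₁ = p)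
    (hq : y ≫ catIncl D Q = q) (hpq : p ≫ P.map Q.t = q ≫ Q.s) :
    (pullback.lift x y h ≫ catComp D Q) ≫ catIncl D Q = Q.comp p q hpq := by
  rw [Category.assoc, catComp_incl, ← Category.assoc]
  congr 1
  apply pullback.hom_ext
  · rw [Category.assoc, lift_catIncl₂_fst, pullback.lift_fst, hp]
  · rw [Category.assoc, lift_catIncl₂_snd, pullback.lift_snd, hq]

lemma lift_catComp_compat (Q : POperad P) {X : E} (x y : X ⟶ catArrows D Q)
    (h : x ≫ catTgt D Q = y ≫ catSrc D Q) :
    (lift (x ≫ catIncl D Q) (y ≫ catShape D Q) ≫ D.const Q.Q₁) ≫ P.map Q.t =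
      (y ≫ catIncl D Q) ≫ Q.s := by
  rw [Category.assoc, D.lift_const_naturality, Category.assoc, Category.assoc, catIncl_s,
    ← catTgt, h, ← Category.assoc, comp_lift]

/-- Operadic associativity is applied to the pair formed by `x` repeated along `y`, and `y`, itself
repeated along the shape of `z`. -/
lemma catOfOperad_assoc (Q : POperad P) [Mono (D.const Q.Q₀)] {X : E} (x y z : X ⟶ catArrows D Q)
    (hxy : x ≫ catTgt D Q = y ≫ catSrc D Q) (hyz : y ≫ catTgt D Q = z ≫ catSrc D Q) (h₁ h₂) :
    pullback.lift (pullback.lift x y hxy ≫ catComp D Q) z h₁ ≫ catComp D Q =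
      pullback.lift x (pullback.lift y z hyz ≫ catComp D Q) h₂ ≫ catComp D Q := by
  have := mono_catIncl D Q
  -- The composable pair coming from `(x, y)`, repeated over the inputs of `z`. By naturality of
  -- repetition, any map out of the composable pairs can be applied before repeating.
  let w := lift (pullback.lift x y hxy ≫ catIncl₂ D Q) (z ≫ catShape D Q) ≫ D.const _
  have hw : ∀ {A : E} (f : pullback (P.map Q.t) Q.s ⟶ A), w ≫ P.map f =
      lift (pullback.lift x y hxy ≫ catIncl₂ D Q ≫ f) (z ≫ catShape D Q) ≫ D.const A := by
    intro A f
    rw [Category.assoc, D.lift_const_naturality, Category.assoc]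
  have h₃ : lift ((pullback.lift x y hxy ≫ catComp D Q) ≫ catIncl D Q) (z ≫ catShape D Q) ≫
      D.const Q.Q₁ = w ≫ P.map Q.m := by
    rw [hw, Category.assoc, catComp_incl]
  have h₄ : lift (y ≫ catIncl D Q) (z ≫ catShape D Q) ≫ D.const Q.Q₁ =
      w ≫ P.map (pullback.snd (P.map Q.t) Q.s) := by
    rw [hw, lift_catIncl₂_snd]
  -- The first component of `w` is a repetition of a repetition of `x`; flattened by `μ`, it is the
  -- repetition of `x` along the shape of the composite of `y` and `z`.
  have h₅ : lift (x ≫ catIncl D Q) ((pullback.lift y z hyz ≫ catComp D Q) ≫ catShape D Q) ≫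
      D.const Q.Q₁ = w ≫ P.map (pullback.fst (P.map Q.t) Q.s) ≫ P.μ.app Q.Q₁ := by
    rw [← Category.assoc w, hw, lift_catIncl₂_fst, Category.assoc, Category.assoc, catComp_shape,
      lift_catShape₂, D.const_const_mu]
  have c₃ := h₃ ▸ lift_catComp_compat D Q _ _ h₁
  have c₄ := h₄ ▸ lift_catComp_compat D Q _ _ hyz
  have e₄ := lift_catComp_incl D Q y z hyz h₄ rfl c₄
  have c₅ := h₅ ▸ e₄ ▸ lift_catComp_compat D Q _ _ h₂
  rw [← cancel_mono (catIncl D Q), lift_catComp_incl D Q _ _ h₁ h₃ rfl c₃,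
    lift_catComp_incl D Q _ _ h₂ h₅ e₄ c₅]
  refine Q.isOperad.comp_assoc w _ ?_ _ _ _
  rw [P.map_comp, ← Category.assoc, c₄]

lemma catOfOperad_isCategory (Q : POperad P) [Mono (D.const Q.Q₀)] :
    (catOfOperad D Q).IsCategory where
  m_s := catComp_src D Q
  m_t := catComp_tgt D Q
  e_s := catUnit_src D Q
  e_t := catUnit_tgt D Q
  assoc := by
    -- The universal composable triple, given by the three projections of the iterated pullback.
    have h := catOfOperad_assoc D Q
      (pullback.fst (pullback.snd (catTgt D Q) (catSrc D Q) ≫ catTgt D Q) (catSrc D Q) ≫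
        pullback.fst (catTgt D Q) (catSrc D Q))
      (pullback.fst (pullback.snd (catTgt D Q) (catSrc D Q) ≫ catTgt D Q) (catSrc D Q) ≫
        pullback.snd (catTgt D Q) (catSrc D Q))
      (pullback.snd (pullback.snd (catTgt D Q) (catSrc D Q) ≫ catTgt D Q) (catSrc D Q))
      (by simp only [Category.assoc, pullback.condition])
      (by simp only [Category.assoc, pullback.condition])
      (by
        rw [Category.assoc, catComp_tgt, pullback.lift_snd_assoc, Category.assoc,
          pullback.condition])
      (by
        rw [Category.assoc _ _ (catSrc D Q), catComp_src, pullback.lift_fst_assoc, Category.assoc,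
          Category.assoc, pullback.condition])
    refine Eq.trans ?_ h
    congr 1
    apply pullback.hom_ext
    · rw [pullback.lift_fst, pullback.lift_fst]
      congr 1
      apply pullback.hom_ext
      · rw [pullback.lift_fst]
      · rw [pullback.lift_snd]
    · rw [pullback.lift_snd, pullback.lift_snd]
  unit_left := by
    have := mono_catIncl D Q
    rw [← cancel_mono (catIncl D Q)]
    refine (lift_catComp_incl D Q _ _ _ ?_ (Category.id_comp _) ?_).trans
      ((Q.isOperad.comp_unit_left _ ?_).trans (Category.id_comp _).symm)
    -- The inputs are a repeated colour, so by naturality placing units on them is the same as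
    -- repeating the unit of that colour.
    · rw [← Category.assoc (catIncl D Q), catIncl_s, Category.assoc, Category.assoc,
        D.lift_const_naturality, catUnit_incl, Category.id_comp]
    · simp [← P.map_comp, Q.isOperad.e_t]
    · simp [← P.map_comp, Q.isOperad.e_t]
  unit_right := by
    have := mono_catIncl D Q
    have h : (catIncl D Q ≫ P.η.app Q.Q₁) ≫ P.map Q.t = (catIncl D Q ≫ Q.t ≫ Q.e) ≫ Q.s := by
      simp only [Category.assoc, Q.isOperad.e_s]
      rw [← CategoryTheory.Monad.unit_naturality E P]
    rw [← cancel_mono (catIncl D Q)]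
    refine (lift_catComp_incl D Q _ _ _ ?_ ?_ h).trans 
      ((Q.isOperad.comp_unit_right _ h).trans (Category.id_comp _).symm)
    -- The unit has the unit shape, and repetition along the unit shape is `η`.
    · rw [Category.assoc, catUnit_shape, ← D.lift_const_eta (catIncl D Q), Category.id_comp,
        ← Category.assoc, toUnit_unique (catTgt D Q ≫ toUnit _) (toUnit _)]
    · rw [Category.assoc, catUnit_incl]
      exact Category.assoc _ _ _

/-! ### The internal category of an operad: functoriality -/

lemma catOfOperadMap_incl {Q B : POperad P} (f : Q ⟶ B) :
    catOfOperadMap D f ≫ catIncl D B = catIncl D Q ≫ f.f₁ :=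
  pullback.lift_snd _ _ _

lemma catOfOperadMap_src {Q B : POperad P} (f : Q ⟶ B) :
    catOfOperadMap D f ≫ catSrc D B = catSrc D Q ≫ f.f₀ := by
  rw [catOfOperadMap, catSrc, pullback.lift_fst_assoc, Category.assoc, whiskerRight_fst,
    catSrc, Category.assoc]

lemma catOfOperadMap_shape {Q B : POperad P} (f : Q ⟶ B) :
    catOfOperadMap D f ≫ catShape D B = catShape D Q := by
  rw [catOfOperadMap, catShape, pullback.lift_fst_assoc, Category.assoc, whiskerRight_snd,
    catShape]

lemma catOfOperadMap_tgt {Q B : POperad P} (f : Q ⟶ B) :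
    catOfOperadMap D f ≫ catTgt D B = catTgt D Q ≫ f.f₀ := by
  rw [catTgt, ← Category.assoc, catOfOperadMap_incl, Category.assoc, f.isMorphism.tgt, catTgt,
    Category.assoc]

/-- The induced map preserves shapes, and repetition is natural in `f₁`; so `f₁` carries the
repetition of `x` along `y` to the repetition of the image of `x` along the image of `y`. Only the
monomorphism for the codomain is needed, since the equations are tested there. -/
lemma catOfOperadMap_isFunctor {Q B : POperad P} (f : Q ⟶ B) [Mono (D.const B.Q₀)] :
    (catOfOperad D Q).IsFunctor (catOfOperad D B) f.f₀ (catOfOperadMap D f) where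
  src := catOfOperadMap_src D f
  tgt := catOfOperadMap_tgt D f
  unit := by
    have := mono_catIncl D B
    rw [← cancel_mono (catIncl D B), Category.assoc, Category.assoc, catOfOperadMap_incl,
      catUnit_incl, ← Category.assoc, catUnit_incl, f.isMorphism.unit]
  comp := by
    have := mono_catIncl D B
    have h : catComp D Q ≫ catOfOperadMap D f ≫ catIncl D B =
        B.comp (catIncl₂ D Q ≫ pullback.fst (P.map Q.t) Q.s ≫ P.map f.f₁)
          (catIncl₂ D Q ≫ pullback.snd (P.map Q.t) Q.s ≫ f.f₁)
          (by
            simp only [Category.assoc]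
            rw [f.isMorphism.src, ← P.map_comp, f.isMorphism.tgt, P.map_comp,
              pullback.condition_assoc]) := by
      rw [catOfOperadMap_incl, ← Category.assoc, catComp_incl, Category.assoc, f.isMorphism.comp]
      exact OperadData.comp_precomp _ _ _ _ _
    rw [← cancel_mono (catIncl D B)]
    refine (Category.assoc _ _ _).trans <| h.trans (lift_catComp_incl D B _ _ _ ?_ ?_ _).symm
    · rw [Category.assoc, Category.assoc, catOfOperadMap_incl, catOfOperadMap_shape, catIncl₂,
        pullback.lift_fst_assoc, Category.assoc, D.lift_const_naturality, Category.assoc]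
    · rw [Category.assoc, catOfOperadMap_incl, catIncl₂, pullback.lift_snd_assoc, Category.assoc]

lemma catOfOperadMap_id (Q : POperad P) : catOfOperadMap D (𝟙 Q) = 𝟙 _ := by
  apply pullback.hom_ext
  · rw [catOfOperadMap, pullback.lift_fst]
    change _ ≫ (𝟙 _) ▷ _ = _
    simp
  · rw [catOfOperadMap, pullback.lift_snd]
    change _ ≫ (𝟙 _) = _
    simp [catIncl]

lemma catOfOperadMap_comp {Q B A : POperad P} (f : Q ⟶ B) (g : B ⟶ A) :
    catOfOperadMap D (f ≫ g) = catOfOperadMap D f ≫ catOfOperadMap D g := by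
  apply pullback.hom_ext
  · rw [Category.assoc]
    simp only [catOfOperadMap, pullback.lift_fst, pullback.lift_fst_assoc]
    change _ ≫ (f.f₀ ≫ g.f₀) ▷ _ = _
    simp
  · rw [Category.assoc]
    refine (catOfOperadMap_incl D (f ≫ g)).trans (Eq.symm ?_)
    refine (congrArg _ (catOfOperadMap_incl D g)).trans ?_
    rw [← Category.assoc, catOfOperadMap_incl, Category.assoc]
    rfl

end

/-! ### The operad of an internal category: axioms -/

section

variable {E : Type u} [Category.{v} E] [CartesianMonoidalCategory E] [HasPullbacks E]
  {P : CategoryTheory.Monad E} [IsCartesianMonad P] (D : Strength P)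

/-- The common target of the arrows of an operation, together with the shape. -/
noncomputable abbrev opBase (C : InternalCat E) : opArrows D C ⟶ C.C₀ ⊗ P.obj (𝟙_ E) :=
  pullback.snd (P.map C.t) (D.const C.C₀)

omit [IsCartesianMonad P] in
lemma mono_opIncl (C : InternalCat E) [Mono (D.const C.C₀)] : Mono (opIncl D C) :=
  inferInstanceAs (Mono (pullback.fst (P.map C.t) (D.const C.C₀)))

lemma opComp_incl (C : InternalCat E) :
    opComp D C ≫ opIncl D C = opIncl₂ D C ≫ P.map (P.map C.m) ≫ P.μ.app C.C₁ :=
  pullback.lift_fst _ _ _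

lemma opComp_base (C : InternalCat E) :
    opComp D C ≫ opBase D C =
      lift (pullback.snd (P.map (opTgt D C)) (opSrc D C) ≫ opTgt D C) (opShape₂ D C) :=
  pullback.lift_snd _ _ _

omit [IsCartesianMonad P] in
lemma opUnit_incl (C : InternalCat E) :
    opUnit D C ≫ opIncl D C = P.η.app C.C₀ ≫ P.map C.e :=
  pullback.lift_fst _ _ _

omit [IsCartesianMonad P] in
lemma opUnit_base (C : InternalCat E) :
    opUnit D C ≫ opBase D C = lift (𝟙 C.C₀) (toUnit C.C₀ ≫ P.η.app (𝟙_ E)) :=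
  pullback.lift_snd _ _ _

omit [IsCartesianMonad P] in
lemma opIncl_map_t (C : InternalCat E) :
    opIncl D C ≫ P.map C.t = opBase D C ≫ D.const C.C₀ :=
  pullback.condition

omit [IsCartesianMonad P] in
lemma opBase_fst (C : InternalCat E) : opBase D C ≫ fst C.C₀ (P.obj (𝟙_ E)) = opTgt D C := rfl

lemma opIncl₂_fst (C : InternalCat E) :
    opIncl₂ D C ≫ P.map (P.map (pullback.fst C.t C.s)) =
      pullback.fst (P.map (opTgt D C)) (opSrc D C) ≫ P.map (opIncl D C) :=
  IsPullback.lift_fst _ _ _ _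

lemma opIncl₂_snd (C : InternalCat E) :
    opIncl₂ D C ≫ P.map (P.map (pullback.snd C.t C.s)) =
      opShapes D C ≫ P.map (D.const C.C₁) :=
  IsPullback.lift_snd _ _ _ _

omit [HasPullbacks E] in
-- `A × X` is the pullback of `A` and `B × X` over `B`, and `P` preserves this pullback, so its two
-- projections stay jointly monic.
lemma map_whiskerRight_hom_ext {A B X Y : E} (f : A ⟶ B) {a b : Y ⟶ P.obj (A ⊗ X)}
    (h₁ : a ≫ P.map (f ▷ X) = b ≫ P.map (f ▷ X))
    (h₂ : a ≫ P.map (fst A X) = b ≫ P.map (fst A X)) : a = b :=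
  (isPullback_map (isPullback_whiskerRight f X)).hom_ext h₁ h₂

/-- The inner shapes are indexed by the inputs of the outer operation, so forgetting each of them
leaves the shape of the outer operation. The map to the terminal object can be factored through
targets, where the configuration is a repetition and `const_toUnit` reads off its shape. -/
lemma opShapes_map_snd_toUnit (C : InternalCat E) :
    opShapes D C ≫ P.map (snd C.C₁ (P.obj (𝟙_ E))) ≫ P.map (toUnit (P.obj (𝟙_ E))) =
      pullback.snd (P.map (opTgt D C)) (opSrc D C) ≫ opBase D C ≫ snd C.C₀ (P.obj (𝟙_ E)) := by
  rw [← P.map_comp, toUnit_unique (snd C.C₁ (P.obj (𝟙_ E)) ≫ toUnit _)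
      (fst C.C₁ (P.obj (𝟙_ E)) ≫ C.t ≫ toUnit _),
    P.map_comp, P.map_comp, reassoc_of% (opShapes_map_fst D C), ← D.const_toUnit,
    reassoc_of% (opIncl_map_t D C)]

lemma lift_opShapes (C : InternalCat E) {X : E} {w : X ⟶ P.obj (opArrows D C)}
    {y : X ⟶ opArrows D C} (h : w ≫ P.map (opTgt D C) = y ≫ opSrc D C)
    {σ : X ⟶ P.obj (C.C₁ ⊗ P.obj (𝟙_ E))}
    (h₁ : σ ≫ P.map (C.s ▷ P.obj (𝟙_ E)) = w ≫ P.map (opBase D C))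
    (h₂ : σ ≫ P.map (fst C.C₁ (P.obj (𝟙_ E))) = y ≫ opIncl D C) :
    pullback.lift w y h ≫ opShapes D C = σ := by
  apply map_whiskerRight_hom_ext C.s
  · rw [Category.assoc, opShapes_map_s, pullback.lift_fst_assoc, h₁]
  · rw [Category.assoc, opShapes_map_fst, pullback.lift_snd_assoc, h₂]

/-- A composite in `T^P(C)` is computed from any configuration of configurations of composable
pairs with the right components. -/
lemma lift_opComp_incl (C : InternalCat E) {X : E} {w : X ⟶ P.obj (opArrows D C)}
    {y : X ⟶ opArrows D C} (h : w ≫ P.map (opTgt D C) = y ≫ opSrc D C)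
    {σ : X ⟶ P.obj (C.C₁ ⊗ P.obj (𝟙_ E))}
    (h₁ : σ ≫ P.map (C.s ▷ P.obj (𝟙_ E)) = w ≫ P.map (opBase D C))
    (h₂ : σ ≫ P.map (fst C.C₁ (P.obj (𝟙_ E))) = y ≫ opIncl D C)
    {τ : X ⟶ P.obj (P.obj (pullback C.t C.s))}
    (h₃ : τ ≫ P.map (P.map (pullback.fst C.t C.s)) = w ≫ P.map (opIncl D C))
    (h₄ : τ ≫ P.map (P.map (pullback.snd C.t C.s)) = σ ≫ P.map (D.const C.C₁)) :
    (pullback.lift w y h ≫ opComp D C) ≫ opIncl D C =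
      τ ≫ P.map (P.map C.m) ≫ P.μ.app C.C₁ := by
  rw [Category.assoc, opComp_incl, ← Category.assoc]
  congr 1
  apply (isPullback_map (isPullback_map (IsPullback.of_hasPullback C.t C.s))).hom_ext
  · rw [Category.assoc, opIncl₂_fst, pullback.lift_fst_assoc, h₃]
  · rw [Category.assoc, opIncl₂_snd, ← Category.assoc, lift_opShapes D C h h₁ h₂, h₄]

lemma opComp_src (C : InternalCat E) :
    opComp D C ≫ opSrc D C =
      pullback.fst (P.map (opTgt D C)) (opSrc D C) ≫ P.map (opSrc D C) ≫ P.μ.app C.C₀ := by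
  change opComp D C ≫ opIncl D C ≫ P.map C.s = _
  rw [← Category.assoc, opComp_incl, Category.assoc, Category.assoc,
    ← CategoryTheory.Monad.mu_naturality E P, ← P.map_comp_assoc, ← P.map_comp, C.isCategory.m_s,
    P.map_comp, P.map_comp, Category.assoc, reassoc_of% (opIncl₂_fst D C), ← P.map_comp_assoc]
  rfl

lemma opComp_tgt (C : InternalCat E) :
    opComp D C ≫ opTgt D C =
      pullback.snd (P.map (opTgt D C)) (opSrc D C) ≫ opTgt D C := by
  change opComp D C ≫ opBase D C ≫ fst _ _ = _
  rw [← Category.assoc, opComp_base, lift_fst]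

omit [IsCartesianMonad P] in
lemma opUnit_src (C : InternalCat E) : opUnit D C ≫ opSrc D C = P.η.app C.C₀ := by
  change opUnit D C ≫ opIncl D C ≫ P.map C.s = _
  rw [← Category.assoc, opUnit_incl, Category.assoc, ← P.map_comp, C.isCategory.e_s, P.map_id,
    Category.comp_id]

omit [IsCartesianMonad P] in
lemma opUnit_tgt (C : InternalCat E) : opUnit D C ≫ opTgt D C = 𝟙 _ := by
  change opUnit D C ≫ opBase D C ≫ fst _ _ = _
  rw [← Category.assoc, opUnit_base, lift_fst]

/-- Think of `z` as the outer operation and of `W` as placing at each of its inputs a middle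
operation with a family of inner ones. The auxiliary configurations `σ`, `π`, `ρ`, `τ`, `θ` record
arrows with shapes at the various levels, and `V` records all composable triples (inner, middle,
outer). Each is obtained, or compared with another, through a pullback preserved by `P`. -/
lemma operadOfCat_assoc (C : InternalCat E) [Mono (D.const C.C₀)] {X : E}
    (W : X ⟶ P.obj (pullback (P.map (opTgt D C)) (opSrc D C))) (z : X ⟶ opArrows D C)
    (h : W ≫ P.map (pullback.snd (P.map (opTgt D C)) (opSrc D C) ≫ opTgt D C) = z ≫ opSrc D C)
    (h₁ h₂ h₃) :
    pullback.lift (W ≫ P.map (opComp D C)) z h₁ ≫ opComp D C =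
      pullback.lift (W ≫ P.map (pullback.fst (P.map (opTgt D C)) (opSrc D C)) ≫
          P.μ.app (opArrows D C))
        (pullback.lift (W ≫ P.map (pullback.snd (P.map (opTgt D C)) (opSrc D C))) z h₂ ≫
          opComp D C) h₃ ≫ opComp D C := by
  have hmono := mono_opIncl D C
  -- the outer shapes
  obtain ⟨σ, hσ⟩ : ∃ σ, σ = pullback.lift
    (W ≫ P.map (pullback.snd (P.map (opTgt D C)) (opSrc D C))) z h₂ ≫ opShapes D C := ⟨_, rfl⟩
  have hσs : σ ≫ P.map (C.s ▷ P.obj (𝟙_ E)) =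
      W ≫ P.map (pullback.snd (P.map (opTgt D C)) (opSrc D C)) ≫ P.map (opBase D C) := by
    rw [hσ, Category.assoc, opShapes_map_s, pullback.lift_fst_assoc, Category.assoc]
  have hσf : σ ≫ P.map (fst C.C₁ (P.obj (𝟙_ E))) = z ≫ opIncl D C := by
    rw [hσ, Category.assoc, opShapes_map_fst, pullback.lift_snd_assoc]
  -- The pairs of a middle arrow and the outer arrow following it.
  obtain ⟨π, hπ⟩ : ∃ π, π = pullback.lift
    (W ≫ P.map (pullback.snd (P.map (opTgt D C)) (opSrc D C))) z h₂ ≫ opIncl₂ D C := ⟨_, rfl⟩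
  have hπf : π ≫ P.map (P.map (pullback.fst C.t C.s)) =
      W ≫ P.map (pullback.snd (P.map (opTgt D C)) (opSrc D C)) ≫ P.map (opIncl D C) := by
    rw [hπ, Category.assoc, opIncl₂_fst, pullback.lift_fst_assoc, Category.assoc]
  have hπs : π ≫ P.map (P.map (pullback.snd C.t C.s)) = σ ≫ P.map (D.const C.C₁) := by
    rw [hπ, Category.assoc, opIncl₂_snd, hσ, Category.assoc]
  have hπm : (pullback.lift (W ≫ P.map (pullback.snd (P.map (opTgt D C)) (opSrc D C))) z h₂ ≫
      opComp D C) ≫ opIncl D C = π ≫ P.map (P.map C.m) ≫ P.μ.app C.C₁ := by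
    rw [Category.assoc, opComp_incl, hπ, Category.assoc]
  -- the inner shapes, placed at the arrows of `z`
  obtain ⟨ρ, hρs, hρf⟩ : ∃ ρ : X ⟶ P.obj (C.C₁ ⊗ P.obj (P.obj (𝟙_ E))),
      ρ ≫ P.map (C.s ▷ P.obj (P.obj (𝟙_ E))) =
        W ≫ P.map (lift (pullback.snd (P.map (opTgt D C)) (opSrc D C) ≫ opTgt D C)
          (opShapes D C ≫ P.map (snd C.C₁ (P.obj (𝟙_ E))))) ∧
      ρ ≫ P.map (fst C.C₁ (P.obj (P.obj (𝟙_ E)))) = z ≫ opIncl D C := by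
    have hc : (W ≫ P.map (lift (pullback.snd (P.map (opTgt D C)) (opSrc D C) ≫ opTgt D C)
          (opShapes D C ≫ P.map (snd C.C₁ (P.obj (𝟙_ E)))))) ≫ P.map (fst _ _) =
        (z ≫ opIncl D C) ≫ P.map C.s := by
      rw [Category.assoc, ← P.map_comp, lift_fst, h, Category.assoc]
      rfl
    exact ⟨_, (isPullback_map (isPullback_whiskerRight C.s _)).lift_fst _ _ hc,
      (isPullback_map (isPullback_whiskerRight C.s _)).lift_snd _ _ hc⟩
  -- Forgetting the inner shapes turns a shape of shapes into the shape of the middle operation.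
  have hρσ : ρ ≫ P.map (C.C₁ ◁ P.map (toUnit (P.obj (𝟙_ E)))) = σ := by
    apply map_whiskerRight_hom_ext C.s
    · rw [Category.assoc, ← P.map_comp, whisker_exchange, P.map_comp, reassoc_of% hρs, hσs,
        ← P.map_comp, ← P.map_comp]
      congr 2
      ext
      · simp [opTgt]
      · simpa using opShapes_map_snd_toUnit D C
    · rw [Category.assoc, ← P.map_comp, whiskerLeft_fst, hρf, hσf]
  -- The strength distributes each outer arrow over the shape of the middle operation, keeping at
  -- every position the shape of the inner operation there.
  obtain ⟨τ, hτ⟩ : ∃ τ, τ = ρ ≫ P.map (D.str C.C₁ (P.obj (𝟙_ E))) := ⟨_, rfl⟩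
  have hτf : τ ≫ P.map (P.map (fst C.C₁ (P.obj (𝟙_ E)))) = σ ≫ P.map (D.const C.C₁) := by
    rw [hτ, Category.assoc, ← P.map_comp, D.str_fst, P.map_comp, reassoc_of% hρσ]
  have hτs : τ ≫ P.map (P.map (C.s ▷ P.obj (𝟙_ E))) =
      W ≫ P.map (opShapes D C) ≫ P.map (P.map (C.t ▷ P.obj (𝟙_ E))) := by
    have hn := D.naturality C.s (𝟙 (P.obj (𝟙_ E)))
    rw [P.map_id, tensorHom_id, tensorHom_id] at hn
    rw [hτ, Category.assoc, ← P.map_comp, ← hn, P.map_comp, reassoc_of% hρs, ← P.map_comp,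
      ← opShapes_map_t, P.map_comp]
  -- the configuration of composable triples
  obtain ⟨V, hVf, hVs⟩ : ∃ V : X ⟶ P.obj (P.obj (P.obj
      (pullback (pullback.snd C.t C.s ≫ C.t) C.s))),
      V ≫ P.map (P.map (P.map (pullback.fst (pullback.snd C.t C.s ≫ C.t) C.s))) =
        W ≫ P.map (opIncl₂ D C) ∧
      V ≫ P.map (P.map (P.map (pullback.snd (pullback.snd C.t C.s ≫ C.t) C.s))) =
        τ ≫ P.map (P.map (D.const C.C₁)) := by
    have hsq := isPullback_map (P := P) (isPullback_map (P := P) (isPullback_map (P := P)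
      (IsPullback.of_hasPullback (pullback.snd C.t C.s ≫ C.t) C.s)))
    -- The gluing condition for triples: the targets of the middle arrows, repeated along the inner
    -- shapes, are the sources of the outer arrows repeated in the same way. The input is `hτs`,
    -- hence `opShapes_map_t`.
    have hc : (W ≫ P.map (opIncl₂ D C)) ≫
          P.map (P.map (P.map (pullback.snd C.t C.s ≫ C.t))) =
        (τ ≫ P.map (P.map (D.const C.C₁))) ≫ P.map (P.map (P.map C.s)) := by
      have e : opIncl₂ D C ≫ P.map (P.map (pullback.snd C.t C.s ≫ C.t)) =
          opShapes D C ≫ P.map (C.t ▷ P.obj (𝟙_ E)) ≫ P.map (D.const C.C₀) := by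
        rw [P.map_comp, P.map_comp, reassoc_of% (opIncl₂_snd D C), ← P.map_comp, ← P.map_comp,
          D.const_naturality]
      have e' : P.map (P.map (D.const C.C₁)) ≫ P.map (P.map (P.map C.s)) =
          P.map (P.map (C.s ▷ P.obj (𝟙_ E))) ≫ P.map (P.map (D.const C.C₀)) := by
        simp only [← P.map_comp, D.const_naturality]
      rw [Category.assoc, ← P.map_comp, e, Category.assoc, e', reassoc_of% hτs]
      simp only [P.map_comp]
    exact ⟨_, hsq.lift_fst _ _ hc, hsq.lift_snd _ _ hc⟩
  -- the pairs of the two outer arrows, with the inner shapes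
  obtain ⟨θ, hθs, hθf⟩ : ∃ θ : X ⟶ P.obj (P.obj (pullback C.t C.s ⊗ P.obj (𝟙_ E))),
      θ ≫ P.map (P.map (pullback.snd C.t C.s ▷ P.obj (𝟙_ E))) = τ ∧
      θ ≫ P.map (P.map (fst _ _)) = π := by
    have hsq := isPullback_map (P := P) (isPullback_map (P := P)
      (isPullback_whiskerRight (pullback.snd C.t C.s) (P.obj (𝟙_ E))))
    have hc := hτf.trans hπs.symm
    exact ⟨_, hsq.lift_fst _ _ hc, hsq.lift_snd _ _ hc⟩
  -- Dropping the outer arrows from `θ` leaves the middle arrows with the inner shapes. The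
  -- comparison is made on the middle arrows and on their targets paired with the inner shapes.
  have hθ : θ ≫ P.map (P.map (pullback.fst C.t C.s ▷ P.obj (𝟙_ E))) =
      W ≫ P.map (opShapes D C) := by
    refine (isPullback_map (isPullback_map (P := P)
      (isPullback_whiskerRight C.t (P.obj (𝟙_ E))))).hom_ext ?_ ?_
    · rw [Category.assoc, Category.assoc, ← hτs, ← hθs, Category.assoc]
      simp only [← P.map_comp, ← comp_whiskerRight, pullback.condition]
    · rw [Category.assoc, Category.assoc, ← P.map_comp, ← P.map_comp, whiskerRight_fst, P.map_comp,
        P.map_comp, reassoc_of% hθf, hπf, ← P.map_comp, ← P.map_comp, opShapes_map_fst]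
  have hr : (pullback.fst (pullback.snd C.t C.s ≫ C.t) C.s ≫ pullback.snd C.t C.s) ≫ C.t =
      pullback.snd (pullback.snd C.t C.s ≫ C.t) C.s ≫ C.s := by
    rw [Category.assoc, pullback.condition]
  have hm₁ : (pullback.fst (pullback.snd C.t C.s ≫ C.t) C.s ≫ C.m) ≫ C.t =
      pullback.snd (pullback.snd C.t C.s ≫ C.t) C.s ≫ C.s := by
    rw [Category.assoc, C.isCategory.m_t, pullback.condition]
  have hm₂ : (pullback.fst (pullback.snd C.t C.s ≫ C.t) C.s ≫ pullback.fst C.t C.s) ≫ C.t =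
      (pullback.lift _ _ hr ≫ C.m) ≫ C.s := by
    rw [Category.assoc, Category.assoc, C.isCategory.m_s, pullback.lift_fst_assoc,
      Category.assoc, pullback.condition]
  -- The last two members of each triple form a pair from `θ`, repeated along the inner shape. This
  -- lets the middle and outer arrows be composed before repeating.
  have hVr : V ≫ P.map (P.map (P.map (pullback.lift
      (pullback.fst (pullback.snd C.t C.s ≫ C.t) C.s ≫ pullback.snd C.t C.s)
      (pullback.snd (pullback.snd C.t C.s ≫ C.t) C.s) hr))) =
      θ ≫ P.map (P.map (D.const (pullback C.t C.s))) := by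
    refine (isPullback_map (isPullback_map (isPullback_map (P := P)
      (IsPullback.of_hasPullback C.t C.s)))).hom_ext ?_ ?_
    · simp only [Category.assoc, ← P.map_comp, pullback.lift_fst]
      rw [← D.const_naturality]
      simp only [P.map_comp]
      rw [reassoc_of% hVf, reassoc_of% hθ, ← P.map_comp, opIncl₂_snd, P.map_comp]
    · simp only [Category.assoc, ← P.map_comp, pullback.lift_snd]
      rw [← D.const_naturality]
      simp only [P.map_comp]
      rw [hVs, reassoc_of% hθs]
  rw [← cancel_mono (opIncl D C)]
  have nat {A B : E} (f : A ⟶ B) :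
      P.map (P.map f) ≫ P.μ.app B = P.μ.app A ≫ P.map f := CategoryTheory.Monad.mu_naturality E P f
  have map_nat {A B : E} (f : A ⟶ B) :
      P.map (P.map (P.map f)) ≫ P.map (P.μ.app B) = P.map (P.μ.app A) ≫ P.map (P.map f) := by
    rw [← P.map_comp, nat, P.map_comp]
  -- Both sides are computed from `V`. On the left the first two members are composed and the two
  -- inner levels merged by `P μ`; on the right the last two are composed and the two outer levels
  -- merged by `μ`.
  refine (lift_opComp_incl D C h₁ (σ := ρ ≫ P.map (C.C₁ ◁ P.μ.app (𝟙_ E)))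
    (τ := V ≫ P.map (P.map (P.map (pullback.lift _ _ hm₁))) ≫ P.map (P.μ.app _))
    ?_ ?_ ?_ ?_).trans (Eq.trans ?_ (lift_opComp_incl D C h₃
    (σ := θ ≫ P.map (P.map (C.m ▷ P.obj (𝟙_ E))) ≫ P.μ.app _)
    (τ := V ≫ P.map (P.map (P.map (pullback.lift _ _ hm₂))) ≫ P.μ.app _)
    ?_ ?_ ?_ ?_).symm)
  · rw [Category.assoc, ← P.map_comp, whisker_exchange, P.map_comp, reassoc_of% hρs, Category.assoc,
      ← P.map_comp, ← P.map_comp, opComp_base]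
    congr 2
    ext <;> simp [opShape₂]
  · rw [Category.assoc, ← P.map_comp, whiskerLeft_fst, hρf]
  · have e : P.map (P.map (P.map (pullback.lift _ _ hm₁))) ≫
          P.map (P.map (P.map (pullback.fst C.t C.s))) =
        P.map (P.map (P.map (pullback.fst (pullback.snd C.t C.s ≫ C.t) C.s))) ≫
          P.map (P.map (P.map C.m)) := by
      simp only [← P.map_comp, pullback.lift_fst]
    rw [Category.assoc, Category.assoc, ← map_nat, reassoc_of% e, reassoc_of% hVf, Category.assoc,
      ← P.map_comp (opComp D C), opComp_incl, P.map_comp, P.map_comp]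
  · have e : P.map (P.map (P.map (pullback.lift _ _ hm₁))) ≫
          P.map (P.map (P.map (pullback.snd C.t C.s))) =
        P.map (P.map (P.map (pullback.snd (pullback.snd C.t C.s ≫ C.t) C.s))) := by
      simp only [← P.map_comp, pullback.lift_snd]
    rw [Category.assoc, Category.assoc, ← map_nat, reassoc_of% e, reassoc_of% hVs, Category.assoc,
      ← P.map_comp (C.C₁ ◁ _), ← D.str_const_mu, P.map_comp, P.map_comp, hτ, Category.assoc]
  -- The only place where the two bracketings meet: associativity in `C` acts on the triples, and
  -- `P.assoc` exchanges the two orders of flattening.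
  · have e := congrArg (fun k => V ≫ P.map (P.map (P.map k)) ≫ P.map (P.μ.app C.C₁) ≫
      P.μ.app C.C₁) C.isCategory.assoc
    simp only [P.map_comp, Category.assoc] at e
    rw [Category.assoc, Category.assoc, Category.assoc, Category.assoc, ← reassoc_of% map_nat, e,
      P.assoc, ← reassoc_of% (nat (P.map C.m))]
  · have e : P.map (P.map (C.m ▷ P.obj (𝟙_ E))) ≫ P.map (P.map (C.s ▷ P.obj (𝟙_ E))) =
        P.map (P.map (pullback.fst C.t C.s ▷ P.obj (𝟙_ E))) ≫
          P.map (P.map (C.s ▷ P.obj (𝟙_ E))) := by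
      simp only [← P.map_comp, ← comp_whiskerRight, C.isCategory.m_s]
    rw [Category.assoc, Category.assoc, ← nat, reassoc_of% e, reassoc_of% hθ, Category.assoc,
      Category.assoc, ← nat, ← P.map_comp_assoc, opShapes_map_s, P.map_comp_assoc]
  · have e : P.map (P.map (C.m ▷ P.obj (𝟙_ E))) ≫ P.map (P.map (fst _ _)) =
        P.map (P.map (fst _ _)) ≫ P.map (P.map C.m) := by
      simp only [← P.map_comp, whiskerRight_fst]
    rw [hπm, Category.assoc, Category.assoc, ← nat, reassoc_of% e, reassoc_of% hθf]
  · have e : P.map (P.map (P.map (pullback.lift _ _ hm₂))) ≫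
          P.map (P.map (P.map (pullback.fst C.t C.s))) =
        P.map (P.map (P.map (pullback.fst (pullback.snd C.t C.s ≫ C.t) C.s))) ≫
          P.map (P.map (P.map (pullback.fst C.t C.s))) := by
      simp only [← P.map_comp, pullback.lift_fst]
    rw [Category.assoc, Category.assoc, ← nat, reassoc_of% e, reassoc_of% hVf, Category.assoc,
      Category.assoc, ← nat, ← P.map_comp_assoc, opIncl₂_fst, P.map_comp_assoc]
  · have e : P.map (P.map (P.map (pullback.lift _ _ hm₂))) ≫
          P.map (P.map (P.map (pullback.snd C.t C.s))) =
        P.map (P.map (P.map (pullback.lift _ _ hr))) ≫ P.map (P.map (P.map C.m)) := by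
      simp only [← P.map_comp, pullback.lift_snd]
    have e' : P.map (P.map (D.const (pullback C.t C.s))) ≫ P.map (P.map (P.map C.m)) =
        P.map (P.map (C.m ▷ P.obj (𝟙_ E))) ≫ P.map (P.map (D.const C.C₁)) := by
      simp only [← P.map_comp, D.const_naturality]
    rw [Category.assoc, Category.assoc, ← nat, reassoc_of% e, reassoc_of% hVr, reassoc_of% e',
      Category.assoc, Category.assoc, ← nat]

lemma operadOfCat_isOperad (C : InternalCat E) [Mono (D.const C.C₀)] :
    (operadOfCat D C).IsOperad where
  m_s := opComp_src D C
  m_t := opComp_tgt D C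
  e_s := opUnit_src D C
  e_t := opUnit_tgt D C
  assoc := operadOfCat_assoc D C _ _ pullback.condition _ _ _
  unit_left := by
    have hmono := mono_opIncl D C
    have hη {A B : E} (f : A ⟶ B) : f ≫ P.η.app B = P.η.app A ≫ P.map f :=
      CategoryTheory.Monad.unit_naturality E P f
    have hse : (C.s ≫ C.e) ≫ C.t = 𝟙 C.C₁ ≫ C.s := by
      rw [Category.assoc, C.isCategory.e_t, Category.comp_id, Category.id_comp]
    rw [← cancel_mono (opIncl D C)]
    -- Every arrow `a` of the operation gets the unit shape, and the one-element configuration of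
    -- the pair of the identity at its source and `a`. Flattening then uses the law for `P η`, which
    -- is `P.right_unit`.
    refine (lift_opComp_incl D C _
      (σ := opIncl D C ≫ P.map (lift (𝟙 _) (toUnit _ ≫ P.η.app (𝟙_ E))))
      (τ := opIncl D C ≫ P.map (P.η.app C.C₁) ≫ P.map (P.map (pullback.lift _ _ hse)))
      ?_ ?_ ?_ ?_).trans ?_
    · have e : opSrc D C ≫ P.map (opUnit D C) ≫ P.map (opBase D C) =
          opIncl D C ≫ P.map C.s ≫ P.map (lift (𝟙 _) (toUnit _ ≫ P.η.app (𝟙_ E))) := by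
        rw [← P.map_comp, opUnit_base]
        exact Category.assoc _ _ _
      refine Eq.trans ?_ (e.symm.trans (Category.assoc _ _ _).symm)
      rw [Category.assoc, ← P.map_comp, ← P.map_comp]
      congr 2
      ext
      · simp
      · simp [comp_toUnit_assoc]
    · rw [Category.assoc, ← P.map_comp, lift_fst, P.map_id, Category.id_comp, Category.comp_id]
    · have e : opSrc D C ≫ P.map (opUnit D C) ≫ P.map (opIncl D C) =
          opIncl D C ≫ P.map C.s ≫ P.map (P.η.app C.C₀ ≫ P.map C.e) := by
        rw [← P.map_comp, opUnit_incl]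
        exact Category.assoc _ _ _
      refine Eq.trans ?_ (e.symm.trans (Category.assoc _ _ _).symm)
      simp only [Category.assoc, ← P.map_comp, pullback.lift_fst]
      rw [P.map_comp C.s C.e, ← reassoc_of% (hη C.s)]
    · rw [Category.assoc, Category.assoc, Category.assoc]
      simp only [← P.map_comp, pullback.lift_snd, D.lift_const_eta]
      simp
    · have e : P.map (P.map (pullback.lift _ _ hse)) ≫ P.map (P.map C.m) = 𝟙 _ := by
        rw [← P.map_comp, ← P.map_comp, C.isCategory.unit_left, P.map_id, P.map_id]
      rw [Category.assoc, Category.assoc, reassoc_of% e, P.right_unit]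
      exact (Category.comp_id _).trans (Category.id_comp _).symm
  unit_right := by
    have hmono := mono_opIncl D C
    have hη {A B : E} (f : A ⟶ B) : f ≫ P.η.app B = P.η.app A ≫ P.map f :=
      CategoryTheory.Monad.unit_naturality E P f
    have hte : 𝟙 C.C₁ ≫ C.t = (C.t ≫ C.e) ≫ C.s := by
      rw [Category.assoc, C.isCategory.e_s, Category.comp_id, Category.id_comp]
    rw [← cancel_mono (opIncl D C)]
    -- The outer operation is a unit, so both witnesses are one-element configurations: the identity
    -- at the target with the shape of the operation, and the configuration of pairs of an arrow and
    -- the identity at its target. Here the law needed is `P.left_unit`.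
    refine (lift_opComp_incl D C _
      (σ := opBase D C ≫ (C.e ▷ P.obj (𝟙_ E)) ≫ P.η.app _)
      (τ := opIncl D C ≫ P.map (pullback.lift _ _ hte) ≫ P.η.app _)
      ?_ ?_ ?_ ?_).trans ?_
    · refine Eq.trans ?_ (hη (opBase D C))
      rw [Category.assoc, Category.assoc, ← hη, ← comp_whiskerRight_assoc, C.isCategory.e_s,
        id_whiskerRight, Category.id_comp]
    · have e : opTgt D C ≫ opUnit D C ≫ opIncl D C =
          opBase D C ≫ fst _ _ ≫ C.e ≫ P.η.app C.C₁ := by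
        rw [opUnit_incl, ← hη, ← opBase_fst, Category.assoc]
      refine Eq.trans ?_ (e.symm.trans (Category.assoc _ _ _).symm)
      rw [Category.assoc, Category.assoc, ← hη, whiskerRight_fst_assoc]
    · refine Eq.trans ?_ (hη (opIncl D C))
      rw [Category.assoc, Category.assoc, ← hη, ← P.map_comp_assoc, pullback.lift_fst, P.map_id,
        Category.id_comp]
    · rw [Category.assoc, Category.assoc, Category.assoc, Category.assoc, ← hη, ← hη,
        ← P.map_comp_assoc, pullback.lift_snd, P.map_comp_assoc, reassoc_of% (opIncl_map_t D C),
        ← reassoc_of% (D.const_naturality C.e)]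
    · rw [Category.assoc, Category.assoc, ← reassoc_of% (hη (P.map C.m)), ← P.map_comp_assoc,
        C.isCategory.unit_right, P.map_id, Category.id_comp, P.left_unit]
      exact (Category.comp_id _).trans (Category.id_comp _).symm

/-! ### The operad of an internal category: functoriality -/

omit [IsCartesianMonad P] in
lemma operadOfCatMap_incl {C B : InternalCat E} (f : C ⟶ B) :
    operadOfCatMap D f ≫ opIncl D B = opIncl D C ≫ P.map f.f₁ :=
  pullback.lift_fst _ _ _

omit [IsCartesianMonad P] in
lemma operadOfCatMap_base {C B : InternalCat E} (f : C ⟶ B) :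
    operadOfCatMap D f ≫ opBase D B = opBase D C ≫ f.f₀ ▷ P.obj (𝟙_ E) :=
  pullback.lift_snd _ _ _

lemma operadOfCatMap_isMorphism {C B : InternalCat E} (f : C ⟶ B) [Mono (D.const B.C₀)] :
    (operadOfCat D C).IsMorphism (operadOfCat D B) f.f₀ (operadOfCatMap D f) where
  src := by
    change operadOfCatMap D f ≫ opIncl D B ≫ P.map B.s = (opIncl D C ≫ P.map C.s) ≫ _
    rw [← Category.assoc, operadOfCatMap_incl, Category.assoc, Category.assoc, ← P.map_comp,
      f.isFunctor.src, P.map_comp]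
  tgt := by
    change operadOfCatMap D f ≫ opBase D B ≫ fst _ _ = (opBase D C ≫ fst _ _) ≫ _
    rw [← Category.assoc, operadOfCatMap_base, Category.assoc, Category.assoc, whiskerRight_fst]
  unit := by
    have hmono := mono_opIncl D B
    rw [← cancel_mono (opIncl D B), Category.assoc, Category.assoc, operadOfCatMap_incl,
      opUnit_incl, ← Category.assoc, opUnit_incl, Category.assoc, ← P.map_comp, f.isFunctor.unit,
      P.map_comp]
    exact (CategoryTheory.Monad.unit_naturality_assoc E P _ _).symm
  comp := by
    have hmono := mono_opIncl D B
    have hc : (pullback.fst C.t C.s ≫ f.f₁) ≫ B.t = (pullback.snd C.t C.s ≫ f.f₁) ≫ B.s := by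
      rw [Category.assoc, Category.assoc, f.isFunctor.tgt, f.isFunctor.src,
        pullback.condition_assoc]
    rw [← cancel_mono (opIncl D B)]
    -- The witnesses for `B` are the images under `f₁` of those for `C`; the shapes do not change.
    refine Eq.trans ?_ (lift_opComp_incl D B _
      (σ := opShapes D C ≫ P.map (f.f₁ ▷ P.obj (𝟙_ E)))
      (τ := opIncl₂ D C ≫ P.map (P.map (pullback.lift _ _ hc))) ?_ ?_ ?_ ?_).symm
    · refine (Category.assoc _ _ _).trans ?_
      rw [operadOfCatMap_incl, ← Category.assoc, opComp_incl, Category.assoc, Category.assoc,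
        Category.assoc, ← CategoryTheory.Monad.mu_naturality E P, ← P.map_comp_assoc,
        ← P.map_comp, ← P.map_comp_assoc, ← P.map_comp, f.isFunctor.comp]
    · rw [Category.assoc, Category.assoc, ← P.map_comp, ← P.map_comp, operadOfCatMap_base,
        ← comp_whiskerRight, f.isFunctor.src, comp_whiskerRight, P.map_comp, P.map_comp,
        reassoc_of% (opShapes_map_s D C)]
    · rw [Category.assoc, Category.assoc, ← P.map_comp, whiskerRight_fst, P.map_comp,
        reassoc_of% (opShapes_map_fst D C), operadOfCatMap_incl]
    · rw [Category.assoc, Category.assoc, ← P.map_comp, ← P.map_comp, ← P.map_comp,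
        pullback.lift_fst, operadOfCatMap_incl, P.map_comp, P.map_comp, P.map_comp,
        reassoc_of% (opIncl₂_fst D C)]
    · rw [Category.assoc, Category.assoc, ← P.map_comp, ← P.map_comp, ← P.map_comp,
        pullback.lift_snd, D.const_naturality, P.map_comp, P.map_comp, P.map_comp,
        reassoc_of% (opIncl₂_snd D C)]

omit [IsCartesianMonad P] in
lemma operadOfCatMap_id (C : InternalCat E) : operadOfCatMap D (𝟙 C) = 𝟙 _ := by
  apply pullback.hom_ext
  · refine (operadOfCatMap_incl D (𝟙 C)).trans ?_
    change _ ≫ P.map (𝟙 _) = _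
    rw [P.map_id, Category.comp_id, Category.id_comp]
    rfl
  · refine (operadOfCatMap_base D (𝟙 C)).trans ?_
    change _ ≫ (𝟙 _) ▷ _ = _
    rw [id_whiskerRight, Category.comp_id, Category.id_comp]

omit [IsCartesianMonad P] in
lemma operadOfCatMap_comp {C B A : InternalCat E} (f : C ⟶ B) (g : B ⟶ A) :
    operadOfCatMap D (f ≫ g) = operadOfCatMap D f ≫ operadOfCatMap D g := by
  apply pullback.hom_ext
  · rw [Category.assoc]
    refine (operadOfCatMap_incl D (f ≫ g)).trans (Eq.symm ?_)
    refine (congrArg _ (operadOfCatMap_incl D g)).trans ?_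
    rw [← Category.assoc, operadOfCatMap_incl, Category.assoc, ← P.map_comp]
    rfl
  · rw [Category.assoc]
    refine (operadOfCatMap_base D (f ≫ g)).trans (Eq.symm ?_)
    refine (congrArg _ (operadOfCatMap_base D g)).trans ?_
    rw [← Category.assoc, operadOfCatMap_base, Category.assoc, ← comp_whiskerRight]
    rfl

end

end TCons

/-! ### The functors and their composite -/

theorem mainTheorem5 {E : Type u} [Category.{v} E] [CartesianMonoidalCategory E] [HasPullbacks E]
    (P' P : CategoryTheory.Monad E) [IsCartesianMonad P'] [IsCartesianMonad P]
    (D' : Strength P') (D : Strength P) :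
    -- `T_{P'}(Q)` is an internal category and `T_{P'}(f)` is an internal functor
    ∃ (hT : ∀ Q : (monoOperad D').FullSubcategory,
        (catOfOperad D' Q.obj).IsCategory)
      (hTmap : ∀ {Q B : (monoOperad D').FullSubcategory} (f : Q ⟶ B),
        (catOfOperad D' Q.obj).IsFunctor (catOfOperad D' B.obj)
          f.hom.f₀ (catOfOperadMap D' f.hom))
      -- `T^P(C)` is a `P`-operad and `T^P(f)` is a morphism of `P`-operads
      (hS : ∀ C : (monoCat D).FullSubcategory,
        (operadOfCat D C.obj).IsOperad)
      (hSmap : ∀ {C B : (monoCat D).FullSubcategory} (f : C ⟶ B),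
        (operadOfCat D C.obj).IsMorphism (operadOfCat D B.obj)
          f.hom.f₀ (operadOfCatMap D f.hom)),
      -- the arrows of `T_{P'}(Q)` are a subobject of the operations of `Q`, and its composition and
      -- unit are the only ones compatible with those of `Q`
      (∀ Q : (monoOperad D').FullSubcategory,
        Mono (catIncl D' Q.obj) ∧
        (∀ c : pullback (catTgt D' Q.obj) (catSrc D' Q.obj) ⟶
            catArrows D' Q.obj,
          c ≫ catIncl D' Q.obj = catIncl₂ D' Q.obj ≫ Q.obj.m ↔
            c = catComp D' Q.obj) ∧
        (∀ i : Q.obj.Q₀ ⟶ catArrows D' Q.obj,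
          i ≫ catIncl D' Q.obj = Q.obj.e ↔ i = catUnit D' Q.obj)) ∧
      -- `T_{P'}` is a functor
      (∃ F : (monoOperad D').FullSubcategory ⥤ InternalCat E,
        F.toPrefunctor =
          { obj := fun Q => ⟨catOfOperad D' Q.obj, hT Q⟩
            map := fun f => ⟨f.hom.f₀, catOfOperadMap D' f.hom, hTmap f⟩ }) ∧
      -- `T^P` is a functor
      (∃ G : (monoCat D).FullSubcategory ⥤ POperad P,
        G.toPrefunctor =
          { obj := fun C => ⟨operadOfCat D C.obj, hS C⟩
            map := fun f => ⟨f.hom.f₀, operadOfCatMap D f.hom, hSmap f⟩ }) ∧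
      -- the composite is a functor from `P'`-operads to `P`-operads
      (∃ K : (monoOperad D' ⊓ fun Q => Mono (D.const Q.Q₀)).FullSubcategory ⥤
          POperad P,
        K.toPrefunctor =
          { obj := fun Q =>
              ⟨operadOfCat D ⟨catOfOperad D' Q.obj, hT ⟨Q.obj, Q.property.1⟩⟩,
                hS ⟨⟨catOfOperad D' Q.obj, hT ⟨Q.obj, Q.property.1⟩⟩, Q.property.2⟩⟩
            map := fun {Q B} f =>
              ⟨f.hom.f₀,
                operadOfCatMap D
                  (C := ⟨catOfOperad D' Q.obj, hT ⟨Q.obj, Q.property.1⟩⟩)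
                  (B := ⟨catOfOperad D' B.obj, hT ⟨B.obj, B.property.1⟩⟩)
                  ⟨f.hom.f₀, catOfOperadMap D' f.hom,
                    hTmap (Q := ⟨Q.obj, Q.property.1⟩) (B := ⟨B.obj, B.property.1⟩) ⟨f.hom⟩⟩,
                hSmap
                  (C := ⟨⟨catOfOperad D' Q.obj, hT ⟨Q.obj, Q.property.1⟩⟩, Q.property.2⟩)
                  (B := ⟨⟨catOfOperad D' B.obj, hT ⟨B.obj, B.property.1⟩⟩, B.property.2⟩)
                  ⟨⟨f.hom.f₀, catOfOperadMap D' f.hom,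
                    hTmap (Q := ⟨Q.obj, Q.property.1⟩) (B := ⟨B.obj, B.property.1⟩)
                      ⟨f.hom⟩⟩⟩⟩ }) := by 
  have hT (Q : (monoOperad D').FullSubcategory) : (catOfOperad D' Q.obj).IsCategory :=
    have : Mono (D'.const Q.obj.Q₀) := Q.property
    catOfOperad_isCategory D' Q.obj
  have hTmap {Q B : (monoOperad D').FullSubcategory} (f : Q ⟶ B) :
      (catOfOperad D' Q.obj).IsFunctor (catOfOperad D' B.obj)
        f.hom.f₀ (catOfOperadMap D' f.hom) :=
    have : Mono (D'.const B.obj.Q₀) := B.property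
    catOfOperadMap_isFunctor D' f.hom
  have hS (C : (monoCat D).FullSubcategory) : (operadOfCat D C.obj).IsOperad :=
    have : Mono (D.const C.obj.C₀) := C.property
    operadOfCat_isOperad D C.obj
  have hSmap {C B : (monoCat D).FullSubcategory} (f : C ⟶ B) :
      (operadOfCat D C.obj).IsMorphism (operadOfCat D B.obj)
        f.hom.f₀ (operadOfCatMap D f.hom) :=
    have : Mono (D.const B.obj.C₀) := B.property
    operadOfCatMap_isMorphism D f.hom
  let F : (monoOperad D').FullSubcategory ⥤ InternalCat E :=
    { obj := fun Q => ⟨catOfOperad D' Q.obj, hT Q⟩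
      map := fun f => ⟨f.hom.f₀, catOfOperadMap D' f.hom, hTmap f⟩
      map_id := fun Q => InternalCat.Hom.ext rfl (catOfOperadMap_id D' Q.obj)
      map_comp := fun f g => InternalCat.Hom.ext rfl (catOfOperadMap_comp D' f.hom g.hom) }
  let G : (monoCat D).FullSubcategory ⥤ POperad P :=
    { obj := fun C => ⟨operadOfCat D C.obj, hS C⟩
      map := fun f => ⟨f.hom.f₀, operadOfCatMap D f.hom, hSmap f⟩
      map_id := fun C => POperad.Hom.ext rfl (operadOfCatMap_id D C.obj)
      map_comp := fun f g => POperad.Hom.ext rfl (operadOfCatMap_comp D f.hom g.hom) }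
  let J : (monoOperad D' ⊓ fun Q => Mono (D.const Q.Q₀)).FullSubcategory ⥤
      (monoOperad D').FullSubcategory := ObjectProperty.ιOfLE inf_le_left
  -- The category built from `Q` has `Q₀` as its object of objects, so the second monomorphism
  -- condition on `Q` is literally the one required of that category.
  let F' : (monoOperad D' ⊓ fun Q => Mono (D.const Q.Q₀)).FullSubcategory ⥤
      (monoCat D).FullSubcategory :=
    ObjectProperty.lift (monoCat D) (J ⋙ F) (fun Q => Q.property.2)
  refine ⟨hT, hTmap, hS, hSmap, fun Q => ?_, ⟨F, rfl⟩, ⟨G, rfl⟩, ⟨F' ⋙ G, rfl⟩⟩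
  have : Mono (D'.const Q.obj.Q₀) := Q.property
  have hmono := mono_catIncl D' Q.obj
  refine ⟨hmono, fun c => ?_, fun i => ?_⟩
  -- Uniqueness is cancellation of the monomorphism `catIncl`.
  · rw [← catComp_incl, cancel_mono]
  · rw [← catUnit_incl, cancel_mono]
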